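/- Let $d\in\mathbb N$, let $\mathbb S^d\subset\mathbb R^{d+1}$ be the unit sphere, and let $\phi_+,\phi_-:[0,\infty)\to\mathbb S^d$ be locally absolutely continuous (absolutely continuous on every $[0,b]$) with $\phi_+(0)=\phi_-(0)$. A (measurable) map $\phi:[0,\infty)^2\to\mathbb S^d$ is called a wave map (in null coordinates) with boundary data $\phi_\pm$ if for all $u_0,v_0>0$ the partial derivatives $\partial_u\phi,\partial_v\phi$ exist almost everywhere on $[0,u_0]\times[0,v_0]$, $\partial_u\phi\cdot\partial_v\phi\in L^1([0,u_0]\times[0,v_0])$, and for all $(u,v)\in[0,u_0]\times[0,v_0]$ $$\phi(u,v)=\phi_+(u)+\phi_-(v)-\phi_+(0)-\int_0^u\!\!\int_0^v\big[(\partial_u\phi\cdot\partial_v\phi)\,\phi\big](w,z)\,dz\,dw .$$ For $Q,P\in\mathbb R^{d+1}$ let $\mathcal R_QP:=2|Q|^{-2}(Q\cdot P)Q-P$ if $Q\neq0$ and $\mathcal R_0P:=-P$. For $N\in\mathbb N$ let $Y:\mathbb N^2\to\mathbb S^d$ be the unique map with $Y(m,0)=\phi_+(2^{-N}m)$, $Y(0,n)=\phi_-(2^{-N}n)$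 and $Y(m+1,n+1)=\mathcal R_{Y(m+1,n)+Y(m,n+1)}Y(m,n)$ for all $m,n\in\mathbb N$. Let $\widetilde Y:[0,\infty)^2\to\mathbb R^{d+1}$ be the extension of $Y$ which on every unit square with integer vertices is affine separately in each variable, and let $\Phi_N(\phi_+,\phi_-)(u,v):=\widetilde Y(2^Nu,2^Nv)$. Then there is a unique wave map $\phi:[0,\infty)^2\to\mathbb S^d$ with boundary data $\phi_\pm$, and $\Phi_N(\phi_+,\phi_-)\to\phi$ locally uniformly on $[0,\infty)^2$ as $N\to\infty$. -/

import Mathlib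

open Set Filter Topology MeasureTheory

noncomputable section

/-- The Euclidean space `ℝ^{d+1}`. -/
abbrev Amb (d : ℕ) : Type := EuclideanSpace ℝ (Fin (d + 1))

/-- The unit sphere `𝕊^d` of `ℝ^{d+1}`. -/
abbrev unitSphere (d : ℕ) : Set (Amb d) := Metric.sphere (0 : Amb d) 1

/-- The closed quadrant `[0, ∞)²`. -/
def quadrant : Set (ℝ × ℝ) := Ici (0 : ℝ) ×ˢ Ici (0 : ℝ)

/-- `f` is locally absolutely continuous on `[0, ∞)`. -/
def LocallyAbsCont {d : ℕ} (f : ℝ → Amb d) : Prop :=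
  ∀ b : ℝ, 0 < b → AbsolutelyContinuousOnInterval f 0 b

/-- The partial derivative `∂_u φ (u, v)`. -/
def partialU {d : ℕ} (φ : ℝ × ℝ → Amb d) (p : ℝ × ℝ) : Amb d :=
  deriv (fun w : ℝ => φ (w, p.2)) p.1

/-- The partial derivative `∂_v φ (u, v)`. -/
def partialV {d : ℕ} (φ : ℝ × ℝ → Amb d) (p : ℝ × ℝ) : Amb d :=
  deriv (fun z : ℝ => φ (p.1, z)) p.2

/-- `φ` is a wave map on the rectangle `[0, u₀] × [0, v₀]`, in null coordinates, with boundary data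
`φp` on `{v = 0}` and `φm` on `{u = 0}`: it is `𝕊^d`-valued, both partial derivatives exist almost
everywhere, `∂_u φ · ∂_v φ` is integrable, and the integrated form of
`∂_u ∂_v φ = -(∂_u φ · ∂_v φ) φ` holds everywhere on the rectangle.
Only the values of `φ` on the rectangle matter. -/
structure IsWaveMapOn {d : ℕ} (u₀ v₀ : ℝ) (φp φm : ℝ → Amb d) (φ : ℝ × ℝ → Amb d) : Prop where
  mem_sphere : ∀ p ∈ Icc 0 u₀ ×ˢ Icc 0 v₀, φ p ∈ unitSphere d
  aestronglyMeasurable :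
    AEStronglyMeasurable φ ((volume : Measure (ℝ × ℝ)).restrict (Icc 0 u₀ ×ˢ Icc 0 v₀))
  differentiable_u : ∀ᵐ p ∂((volume : Measure (ℝ × ℝ)).restrict (Icc 0 u₀ ×ˢ Icc 0 v₀)),
    DifferentiableAt ℝ (fun w : ℝ => φ (w, p.2)) p.1
  differentiable_v : ∀ᵐ p ∂((volume : Measure (ℝ × ℝ)).restrict (Icc 0 u₀ ×ˢ Icc 0 v₀)),
    DifferentiableAt ℝ (fun z : ℝ => φ (p.1, z)) p.2
  integrable_inner : IntegrableOn (fun p : ℝ × ℝ => inner ℝ (partialU φ p) (partialV φ p))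
    (Icc 0 u₀ ×ˢ Icc 0 v₀) volume
  integral_eq : ∀ u ∈ Icc 0 u₀, ∀ v ∈ Icc 0 v₀,
    φ (u, v) = φp u + φm v - φp 0 -
      ∫ w in (0 : ℝ)..u, ∫ z in (0 : ℝ)..v,
        (inner ℝ (partialU φ (w, z)) (partialV φ (w, z)) : ℝ) • φ (w, z)

/-- `φ` is a wave map on the quadrant `[0, ∞)²` with boundary data `φp`, `φm`: it is one on every
rectangle `[0, u₀] × [0, v₀]`. -/
def IsWaveMap {d : ℕ} (φp φm : ℝ → Amb d) (φ : ℝ × ℝ → Amb d) : Prop :=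
  ∀ u₀ v₀ : ℝ, 0 < u₀ → 0 < v₀ → IsWaveMapOn u₀ v₀ φp φm φ

/-- The reflection of `P` with respect to the line spanned by `Q`,
with the convention that it is `-P` for `Q = 0`. -/
def lineReflection {d : ℕ} (Q P : Amb d) : Amb d :=
  if Q = 0 then -P else (2 * (‖Q‖ ^ 2)⁻¹ * inner ℝ Q P) • Q - P

/-- `Y : ℕ² → 𝕊^d` is a discrete wave map with boundary data `Yp`, `Ym`. -/
structure IsDiscreteWaveMap {d : ℕ} (Yp Ym : ℕ → Amb d) (Y : ℕ → ℕ → Amb d) : Prop where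
  mem_sphere : ∀ m n, Y m n ∈ unitSphere d
  left : ∀ m, Y m 0 = Yp m
  right : ∀ n, Y 0 n = Ym n
  step : ∀ m n, Y (m + 1) (n + 1) = lineReflection (Y (m + 1) n + Y m (n + 1)) (Y m n)

/-- The discrete wave map with boundary data `Yp`, `Ym`, by recursion. -/
def discreteWaveMap {d : ℕ} (Yp Ym : ℕ → Amb d) : ℕ → ℕ → Amb d
  | m, 0 => Yp m
  | 0, n + 1 => Ym (n + 1)
  | m + 1, n + 1 =>
    lineReflection (discreteWaveMap Yp Ym (m + 1) n + discreteWaveMap Yp Ym m (n + 1))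
      (discreteWaveMap Yp Ym m n)
termination_by m n => m + n

theorem norm_lineReflection {d : ℕ} (Q P : Amb d) : ‖lineReflection Q P‖ = ‖P‖ := by
  unfold lineReflection
  split_ifs with h
  · exact norm_neg P
  · have hQ : ‖Q‖ ≠ 0 := norm_ne_zero_iff.mpr h
    have : ‖(2 * (‖Q‖ ^ 2)⁻¹ * inner ℝ Q P) • Q - P‖ ^ 2 = ‖P‖ ^ 2 := by
      rw [norm_sub_sq_real, norm_smul, inner_smul_left, mul_pow, Real.norm_eq_abs, sq_abs]
      simp only [conj_trivial]
      field_simp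
      ring
    exact (sq_eq_sq₀ (norm_nonneg _) (norm_nonneg _)).mp this

/-- For sphere-valued data with `Yp 0 = Ym 0`, the recursion gives the unique discrete wave map. -/
theorem isDiscreteWaveMap_iff {d : ℕ} {Yp Ym : ℕ → Amb d}
    (hp : ∀ n, Yp n ∈ unitSphere d) (hm : ∀ n, Ym n ∈ unitSphere d) (h0 : Yp 0 = Ym 0)
    (Y : ℕ → ℕ → Amb d) : IsDiscreteWaveMap Yp Ym Y ↔ Y = discreteWaveMap Yp Ym := by
  constructor
  · intro h
    have key : ∀ k m n, m + n = k → Y m n = discreteWaveMap Yp Ym m n := by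
      intro k
      induction k using Nat.strong_induction_on with
      | _ k ih =>
        intro m n hk
        match m, n with
        | m, 0 => rw [discreteWaveMap, h.left]
        | 0, n + 1 => rw [discreteWaveMap, h.right]
        | m + 1, n + 1 =>
          rw [discreteWaveMap, h.step, ih (m + 1 + n) (by omega) _ _ rfl,
            ih (m + (n + 1)) (by omega) _ _ rfl, ih (m + n) (by omega) _ _ rfl]
    funext m n
    exact key _ m n rfl
  · rintro rfl
    refine ⟨?_, ?_, ?_, ?_⟩
    · have key : ∀ k m n, m + n = k → discreteWaveMap Yp Ym m n ∈ unitSphere d := by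
        intro k
        induction k using Nat.strong_induction_on with
        | _ k ih =>
          intro m n hk
          match m, n with
          | m, 0 => rw [discreteWaveMap]; exact hp m
          | 0, n + 1 => rw [discreteWaveMap]; exact hm _
          | m + 1, n + 1 =>
            have := ih (m + n) (by omega) _ _ rfl
            rw [mem_sphere_zero_iff_norm] at this ⊢
            rw [discreteWaveMap, norm_lineReflection, this]
      exact fun m n => key _ m n rfl
    · intro m; rw [discreteWaveMap]
    · intro n
      cases n with
      | zero => rw [discreteWaveMap, h0]
      | succ n => rw [discreteWaveMap]
    · intro m n; rw [discreteWaveMap]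

/-- The extension of a field on `ℕ²` to `[0, ∞)²`, affine in each variable on every unit square. -/
def gridExtension {d : ℕ} (Y : ℕ → ℕ → Amb d) (p : ℝ × ℝ) : Amb d :=
  ((1 - Int.fract p.1) * (1 - Int.fract p.2)) • Y ⌊p.1⌋₊ ⌊p.2⌋₊ +
  (Int.fract p.1 * (1 - Int.fract p.2)) • Y (⌊p.1⌋₊ + 1) ⌊p.2⌋₊ +
  ((1 - Int.fract p.1) * Int.fract p.2) • Y ⌊p.1⌋₊ (⌊p.2⌋₊ + 1) +
  (Int.fract p.1 * Int.fract p.2) • Y (⌊p.1⌋₊ + 1) (⌊p.2⌋₊ + 1)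

/-- The solution `Φ_N(φp, φm)` of the discrete scheme with mesh size `2^{-N}`. -/
def schemeSolution {d : ℕ} (N : ℕ) (φp φm : ℝ → Amb d) (p : ℝ × ℝ) : Amb d :=
  gridExtension
    (discreteWaveMap (fun n : ℕ => φp ((n : ℝ) / 2 ^ N)) (fun n : ℕ => φm ((n : ℝ) / 2 ^ N)))
    (2 ^ N * p.1, 2 ^ N * p.2)

end

/-! Existence and uniqueness both come from stability of the scheme. For unit vectors `X ≠ -Z` the
reflection in the line of `X + Z` exchanges `X` and `Z`, so it is an isometry taking `P - X` to `R P
- Z`; the convention at `0` gives the same equality of lengths. Hence opposite edges of every cell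
have equal length: the increments in `u` keep the length they have on `{v = 0}`, those in `v` the
length they have on `{u = 0}`. All bounds are then in terms of the arc lengths of the data, and no
energy beyond `L¹` is needed.

On a cell with edges of length at most `s`, `t`, the mixed difference is `-(Δ_u Y · Δ_v Y) Y` up to
an error of order `(s + t) s t`. Summing over cells gives the same on grid rectangles, with a
constant independent of the mesh (`norm_rectangle_le`). So a fine solution restricted to a coarse
grid solves the coarse scheme up to third order errors, and the discrete Grönwall estimate
`norm_sub_le_of_approx` makes the solutions Cauchy, uniformly on bounded squares.

The limit inherits the bounds on increments and rectangles and thus, extended to the plane, is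
controlled in the sense of `IsControlled`. A controlled field has partial derivatives almost
everywhere, and the integral of its wave density over a rectangle agrees with `(Δ_u φ · Δ_v φ) φ` to
third order (`norm_integral_waveDensity_sub_le`). Adding the two estimates, `φ` plus the primitive
of its density has mixed differences of third order; these are additive over subdivisions, hence
zero (`mixedDiff_eq_zero`). This is the integrated equation.

For uniqueness, `|ψ| = 1` makes `∂_u ψ` orthogonal to `ψ`, hence to `∂_v ∂_u ψ`, so `|∂_u ψ|` is
independent of `v`, and symmetrically (`norm_goursatU_eq`). Any wave map is therefore controlled,
its samples on the grid solve the scheme up to third order errors, and Grönwall forces the scheme to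
converge to it. Limits being unique, all wave maps agree. -/

noncomputable section

/-! ### The reflection step on a single cell -/

/-- The reflection fixes the bisector of `X` and `Z` and so exchanges them; by linearity `R P - Z =
R (P - X)`. In the degenerate case `Z = -X` the convention `R P = -P` gives the same norm. -/
theorem norm_lineReflection_sub {d : ℕ} {P X Z : Amb d} (hX : ‖X‖ = 1) (hZ : ‖Z‖ = 1) :
    ‖lineReflection (X + Z) P - Z‖ = ‖X - P‖ := by
  by_cases hQ : X + Z = 0
  · have hZ' : Z = -X := by rw [add_comm] at hQ; exact eq_neg_of_add_eq_zero_left hQ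
    rw [lineReflection, if_pos hQ, hZ']
    congr 1
    abel
  · have hswap : lineReflection (X + Z) X = Z := by
      rw [lineReflection, if_neg hQ]
      have h1 : ‖X + Z‖ ^ 2 = 2 * inner ℝ (X + Z) X := by
        rw [norm_add_sq_real, inner_add_left, real_inner_self_eq_norm_sq, real_inner_comm, hX, hZ]
        ring
      have h2 : ‖X + Z‖ ^ 2 ≠ 0 := pow_ne_zero _ (norm_ne_zero_iff.mpr hQ)
      have h3 : 2 * (‖X + Z‖ ^ 2)⁻¹ * inner ℝ (X + Z) X = 1 := by
        rw [mul_right_comm, ← h1, mul_inv_cancel₀ h2]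
      rw [h3, one_smul, add_sub_cancel_left]
    have hlin : lineReflection (X + Z) P - Z = lineReflection (X + Z) (P - X) := by
      conv_lhs => rw [← hswap]
      rw [hswap]
      simp only [lineReflection, if_neg hQ, inner_sub_right, mul_sub, sub_smul] at hswap ⊢
      rw [← sub_eq_zero]
      conv_lhs => enter [1, 2]; rw [← hswap]
      abel
    rw [hlin, norm_lineReflection, norm_sub_rev]

/-- Small cells are nondegenerate: `X + Z` stays near `2 P`, so inverse powers of its norm are at
most `1`. -/
theorem one_le_norm_add {d : ℕ} {P X Z : Amb d} (hP : ‖P‖ = 1) {s t : ℝ} (hs : ‖X - P‖ ≤ s)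
    (ht : ‖Z - P‖ ≤ t) (hst : s + t ≤ 1) : 1 ≤ ‖X + Z‖ := by
  have h1 : ‖(2 : ℝ) • P‖ = 2 := by rw [norm_smul, hP]; norm_num
  have h2 : (2 : ℝ) • P = (X + Z) - ((X - P) + (Z - P)) := by rw [two_smul]; abel
  have h3 := norm_sub_le (X + Z) ((X - P) + (Z - P))
  rw [← h2, h1] at h3
  linarith [norm_add_le (X - P) (Z - P)]

/-- An exact identity: for unit vectors `|X + Z|² - 2 (X + Z) · P = 2 (X - P) · (Z - P)`, so the
coefficient of the reflection differs from `1` by a multiple of the product of the two edges. -/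
theorem lineReflection_sub_sub_add {d : ℕ} {P X Z : Amb d} (hP : ‖P‖ = 1) (hX : ‖X‖ = 1)
    (hZ : ‖Z‖ = 1) (hQ : X + Z ≠ 0) :
    lineReflection (X + Z) P - X - Z + P =
      -(inner ℝ (X - P) (Z - P) * 2 * (‖X + Z‖ ^ 2)⁻¹) • (X + Z) := by
  rw [lineReflection, if_neg hQ]
  have h2 : ‖X + Z‖ ^ 2 ≠ 0 := pow_ne_zero _ (norm_ne_zero_iff.mpr hQ)
  have h1 : ‖X + Z‖ ^ 2 = 2 * inner ℝ (X + Z) P + 2 * inner ℝ (X - P) (Z - P) := by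
    rw [norm_add_sq_real, inner_add_left, inner_sub_left, inner_sub_right, inner_sub_right,
      real_inner_self_eq_norm_sq, real_inner_comm P Z, hP, hX, hZ, real_inner_comm Z P]
    ring
  have h3 : 2 * (‖X + Z‖ ^ 2)⁻¹ * inner ℝ (X + Z) P =
      1 - inner ℝ (X - P) (Z - P) * 2 * (‖X + Z‖ ^ 2)⁻¹ := by
    have : inner ℝ (X + Z) P = ‖X + Z‖ ^ 2 / 2 - inner ℝ (X - P) (Z - P) := by linarith
    rw [this]
    field_simp
  rw [h3, sub_smul, one_smul, neg_smul]
  abel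

theorem norm_lineReflection_sub_sub_add_le {d : ℕ} {P X Z : Amb d} (hP : ‖P‖ = 1) (hX : ‖X‖ = 1)
    (hZ : ‖Z‖ = 1) {s t : ℝ} (hs : ‖X - P‖ ≤ s) (ht : ‖Z - P‖ ≤ t) (hst : s + t ≤ 1) :
    ‖lineReflection (X + Z) P - X - Z + P‖ ≤ 2 * (s * t) := by
  have hQ1 := one_le_norm_add hP hs ht hst
  have hQ : X + Z ≠ 0 := norm_pos_iff.mp (by linarith)
  rw [lineReflection_sub_sub_add hP hX hZ hQ, norm_smul, norm_neg, norm_mul, norm_mul, norm_inv,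
    norm_pow, norm_norm, Real.norm_ofNat, mul_assoc, mul_assoc]
  have h1 : (‖X + Z‖ ^ 2)⁻¹ * ‖X + Z‖ ≤ 1 := by
    have : (‖X + Z‖ ^ 2)⁻¹ * ‖X + Z‖ = ‖X + Z‖⁻¹ := by field_simp
    rw [this]
    exact inv_le_one_of_one_le₀ hQ1
  have h2 : ‖(inner ℝ (X - P) (Z - P) : ℝ)‖ ≤ s * t :=
    (norm_inner_le_norm _ _).trans (mul_le_mul hs ht (norm_nonneg _) ((norm_nonneg _).trans hs))
  have h3 : 0 ≤ s * t := (norm_nonneg _).trans h2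
  calc _ ≤ (s * t) * (2 * 1) := by gcongr
    _ = _ := by ring

/-- Consistency of the scheme with the wave map equation. With `X + Z = 2 P + r` and `|X + Z|² = 4 +
4 P · r + |r|²` the leading terms cancel; the rest is at most `4|r| + |r|² + 2|r| ≤ 7 (s + t)`, as
`s + t ≤ 1`. -/
theorem norm_lineReflection_sub_sub_add_add_le {d : ℕ} {P X Z : Amb d} (hP : ‖P‖ = 1)
    (hX : ‖X‖ = 1) (hZ : ‖Z‖ = 1) {s t : ℝ} (hs : ‖X - P‖ ≤ s) (ht : ‖Z - P‖ ≤ t)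
    (hst : s + t ≤ 1) :
    ‖lineReflection (X + Z) P - X - Z + P + (inner ℝ (X - P) (Z - P) : ℝ) • P‖ ≤
      7 * (s + t) * (s * t) := by
  have hQ1 := one_le_norm_add hP hs ht hst
  have hQ : X + Z ≠ 0 := norm_pos_iff.mp (by linarith)
  have hs0 : 0 ≤ s := (norm_nonneg _).trans hs
  have ht0 : 0 ≤ t := (norm_nonneg _).trans ht
  rw [lineReflection_sub_sub_add hP hX hZ hQ]
  set r : Amb d := (X - P) + (Z - P) with hr
  have hrn : ‖r‖ ≤ s + t := (norm_add_le _ _).trans (add_le_add hs ht)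
  have hQr : X + Z = (2 : ℝ) • P + r := by rw [hr, two_smul]; abel
  have hsq : ‖X + Z‖ ^ 2 = 4 + 4 * inner ℝ P r + ‖r‖ ^ 2 := by
    rw [hQr, norm_add_sq_real, norm_smul, inner_smul_left, hP]
    simp
    ring
  have hpos : 0 < ‖X + Z‖ ^ 2 := by positivity
  have key : -(inner ℝ (X - P) (Z - P) * 2 * (‖X + Z‖ ^ 2)⁻¹) • (X + Z) +
      (inner ℝ (X - P) (Z - P) : ℝ) • P =
      (inner ℝ (X - P) (Z - P) * (‖X + Z‖ ^ 2)⁻¹) •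
        ((4 * inner ℝ P r + ‖r‖ ^ 2) • P - (2 : ℝ) • r) := by
    have h4 : (inner ℝ (X - P) (Z - P) : ℝ) =
        inner ℝ (X - P) (Z - P) * (‖X + Z‖ ^ 2)⁻¹ * (4 + 4 * inner ℝ P r + ‖r‖ ^ 2) := by
      rw [← hsq, mul_assoc, inv_mul_cancel₀ hpos.ne', mul_one]
    conv_lhs => enter [2]; rw [h4]
    conv_lhs => enter [1, 2]; rw [hQr]
    module
  rw [key, norm_smul, norm_mul, norm_inv, norm_pow, norm_norm]
  have h2 : ‖(inner ℝ (X - P) (Z - P) : ℝ)‖ ≤ s * t :=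
    (norm_inner_le_norm _ _).trans (mul_le_mul hs ht (norm_nonneg _) hs0)
  have h3 : (‖X + Z‖ ^ 2)⁻¹ ≤ 1 := inv_le_one_of_one_le₀ (one_le_pow₀ hQ1)
  have hPr : |inner ℝ P r| ≤ ‖r‖ := by
    have := abs_real_inner_le_norm P r
    rwa [hP, one_mul] at this
  have h4 : ‖(4 * inner ℝ P r + ‖r‖ ^ 2) • P - (2 : ℝ) • r‖ ≤ 7 * (s + t) := by
    refine (norm_sub_le _ _).trans ?_
    rw [norm_smul, norm_smul, hP, mul_one, Real.norm_ofNat, Real.norm_eq_abs]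
    have : |4 * inner ℝ P r + ‖r‖ ^ 2| ≤ 4 * ‖r‖ + ‖r‖ ^ 2 := by
      refine (abs_add_le _ _).trans ?_
      rw [abs_mul, abs_of_nonneg (sq_nonneg ‖r‖)]
      norm_num
      linarith
    nlinarith [norm_nonneg r]
  calc _ ≤ (s * t) * 1 * (7 * (s + t)) := by gcongr
    _ = _ := by ring

/-! ### Discrete conservation law and estimates on grid rectangles -/

namespace IsDiscreteWaveMap

variable {d : ℕ} {Yp Ym : ℕ → Amb d} {Y : ℕ → ℕ → Amb d}

theorem norm_eq_one (h : IsDiscreteWaveMap Yp Ym Y) (m n : ℕ) : ‖Y m n‖ = 1 :=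
  mem_sphere_zero_iff_norm.mp (h.mem_sphere m n)

/-- Discrete conservation of energy: each reflection carries the length of an edge to the opposite
edge. -/
theorem norm_sub_left (h : IsDiscreteWaveMap Yp Ym Y) (m n : ℕ) :
    ‖Y (m + 1) n - Y m n‖ = ‖Yp (m + 1) - Yp m‖ := by
  induction n with
  | zero => rw [h.left, h.left]
  | succ n ih =>
    rw [h.step, norm_lineReflection_sub (h.norm_eq_one _ _) (h.norm_eq_one _ _), ih]

theorem norm_sub_right (h : IsDiscreteWaveMap Yp Ym Y) (m n : ℕ) :
    ‖Y m (n + 1) - Y m n‖ = ‖Ym (n + 1) - Ym n‖ := by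
  induction m with
  | zero => rw [h.right, h.right]
  | succ m ih =>
    rw [h.step, add_comm (Y (m + 1) n),
      norm_lineReflection_sub (h.norm_eq_one _ _) (h.norm_eq_one _ _), ih]

end IsDiscreteWaveMap

/-- Passing from cells to rectangles: if on every cell of a grid rectangle the second mixed
difference of `Y` is `-(Δ_u Y · Δ_v Y) Y` up to a small error, then so it is on the rectangle. -/
theorem norm_rectangle_le {d : ℕ} {Y : ℕ → ℕ → Amb d} {α β : ℕ → ℝ} {m m' n n' : ℕ}
    (hm : m ≤ m') (hn : n ≤ n') (hα : Monotone α) (hβ : Monotone β)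
    (hY : ‖Y m n‖ = 1)
    (hu : ∀ i j, m ≤ i → i < m' → n ≤ j → j ≤ n' → ‖Y (i + 1) j - Y i j‖ ≤ α (i + 1) - α i)
    (hv : ∀ i j, m ≤ i → i ≤ m' → n ≤ j → j < n' → ‖Y i (j + 1) - Y i j‖ ≤ β (j + 1) - β j)
    (hc : ∀ i j, m ≤ i → i < m' → n ≤ j → j < n' →
      ‖Y (i + 1) (j + 1) - Y (i + 1) j - Y i (j + 1) + Y i j‖ ≤
        2 * ((α (i + 1) - α i) * (β (j + 1) - β j)))
    (hd : ∀ i j, m ≤ i → i < m' → n ≤ j → j < n' →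
      ‖Y (i + 1) (j + 1) - Y (i + 1) j - Y i (j + 1) + Y i j +
        (inner ℝ (Y (i + 1) j - Y i j) (Y i (j + 1) - Y i j) : ℝ) • Y i j‖ ≤
        7 * (α (i + 1) - α i + (β (j + 1) - β j)) * ((α (i + 1) - α i) * (β (j + 1) - β j))) :
    ‖Y m' n' - Y m' n - Y m n' + Y m n‖ ≤ 2 * ((α m' - α m) * (β n' - β n)) ∧
    ‖Y m' n' - Y m' n - Y m n' + Y m n +
      (inner ℝ (Y m' n - Y m n) (Y m n' - Y m n) : ℝ) • Y m n‖ ≤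
      12 * (α m' - α m + (β n' - β n)) * ((α m' - α m) * (β n' - β n)) := by
  have tel : ∀ {G : Type} [AddCommGroup G] (f : ℕ → G) {k l : ℕ}, k ≤ l →
      ∑ i ∈ Finset.Ico k l, (f (i + 1) - f i) = f l - f k := by
    intro G _ f k l hkl
    exact Finset.sum_Ico_sub f hkl
  have hAB : ∑ i ∈ Finset.Ico m m', ∑ j ∈ Finset.Ico n n',
      (α (i + 1) - α i) * (β (j + 1) - β j) = (α m' - α m) * (β n' - β n) := by
    rw [← tel α hm, ← tel β hn, Finset.sum_mul_sum]
  have hbox : ∀ k l, k ≤ m' → l ≤ n' → m ≤ k → n ≤ l →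
      ∑ i ∈ Finset.Ico m k, ∑ j ∈ Finset.Ico n l,
      (Y (i + 1) (j + 1) - Y (i + 1) j - Y i (j + 1) + Y i j) =
        Y k l - Y k n - Y m l + Y m n := by
    intro k l _ _ hk hl
    have h1 : ∀ i, ∑ j ∈ Finset.Ico n l, (Y (i + 1) (j + 1) - Y (i + 1) j - Y i (j + 1) + Y i j) =
        (Y (i + 1) l - Y (i + 1) n) - (Y i l - Y i n) := by
      intro i
      rw [← tel (Y (i + 1)) hl, ← tel (Y i) hl, ← Finset.sum_sub_distrib]
      exact Finset.sum_congr rfl fun j _ => by abel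
    rw [Finset.sum_congr rfl fun i _ => h1 i, tel (fun i => Y i l - Y i n) hk]
    abel
  have ha0 : ∀ i, 0 ≤ α (i + 1) - α i := fun i => sub_nonneg.mpr (hα (Nat.le_succ i))
  have hb0 : ∀ j, 0 ≤ β (j + 1) - β j := fun j => sub_nonneg.mpr (hβ (Nat.le_succ j))
  have hA0 : 0 ≤ α m' - α m := sub_nonneg.mpr (hα hm)
  have hB0 : 0 ≤ β n' - β n := sub_nonneg.mpr (hβ hn)
  refine ⟨?_, ?_⟩
  · rw [← hbox m' n' le_rfl le_rfl hm hn, ← hAB, Finset.mul_sum]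
    refine (norm_sum_le _ _).trans (Finset.sum_le_sum fun i hi => ?_)
    rw [Finset.mul_sum]
    refine (norm_sum_le _ _).trans (Finset.sum_le_sum fun j hj => ?_)
    rw [Finset.mem_Ico] at hi hj
    exact hc i j hi.1 hi.2 hj.1 hj.2
  -- By bilinearity the product of the two edge increments of the rectangle is a double sum over
  -- cells. In each cell it is compared with the local product: `p`, `q` and `y` differ from their
  -- values on the edges by at most `2aB`, `2Ab` and `A + B`. This adds `3 (A + B) a b` to the error
  -- `7 (A + B) a b`, so `12` leaves room.
  · have hin : (inner ℝ (Y m' n - Y m n) (Y m n' - Y m n) : ℝ) • Y m n =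
        ∑ i ∈ Finset.Ico m m', ∑ j ∈ Finset.Ico n n',
          (inner ℝ (Y (i + 1) n - Y i n) (Y m (j + 1) - Y m j) : ℝ) • Y m n := by
      rw [← tel (fun i => Y i n) hm, ← tel (fun j => Y m j) hn, sum_inner]
      simp_rw [inner_sum, Finset.sum_smul]
    rw [hin, ← hbox m' n' le_rfl le_rfl hm hn, ← Finset.sum_add_distrib, ← hAB, Finset.mul_sum]
    refine (norm_sum_le _ _).trans (Finset.sum_le_sum fun i hi => ?_)
    rw [Finset.mul_sum, ← Finset.sum_add_distrib]
    refine (norm_sum_le _ _).trans (Finset.sum_le_sum fun j hj => ?_)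
    rw [Finset.mem_Ico] at hi hj
    have hai : α (i + 1) - α i ≤ α m' - α m := sub_le_sub (hα hi.2) (hα hi.1)
    have hbj : β (j + 1) - β j ≤ β n' - β n := sub_le_sub (hβ hj.2) (hβ hj.1)
    have hp : ‖(Y (i + 1) j - Y i j) - (Y (i + 1) n - Y i n)‖ ≤
        2 * ((α (i + 1) - α i) * (β n' - β n)) := by
      have h1 : (Y (i + 1) j - Y i j) - (Y (i + 1) n - Y i n) = ∑ k ∈ Finset.Ico n j,
          (Y (i + 1) (k + 1) - Y (i + 1) k - Y i (k + 1) + Y i k) := by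
        rw [show (Y (i + 1) j - Y i j) - (Y (i + 1) n - Y i n) =
          (Y (i + 1) j - Y (i + 1) n) - (Y i j - Y i n) by abel, ← tel (Y (i + 1)) hj.1,
          ← tel (Y i) hj.1, ← Finset.sum_sub_distrib]
        exact Finset.sum_congr rfl fun j _ => by abel
      rw [h1]
      refine (norm_sum_le _ _).trans ?_
      calc _ ≤ ∑ k ∈ Finset.Ico n j, 2 * ((α (i + 1) - α i) * (β (k + 1) - β k)) := by
            refine Finset.sum_le_sum fun k hk => ?_
            rw [Finset.mem_Ico] at hk
            exact hc i k hi.1 hi.2 hk.1 (hk.2.trans hj.2)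
        _ = 2 * ((α (i + 1) - α i) * (β j - β n)) := by
            rw [← Finset.mul_sum, ← Finset.mul_sum, tel β hj.1]
        _ ≤ _ := by
            have := hβ hj.2.le
            have := ha0 i
            gcongr
    have hq : ‖(Y i (j + 1) - Y i j) - (Y m (j + 1) - Y m j)‖ ≤
        2 * ((α m' - α m) * (β (j + 1) - β j)) := by
      have h1 : (Y i (j + 1) - Y i j) - (Y m (j + 1) - Y m j) = ∑ k ∈ Finset.Ico m i,
          (Y (k + 1) (j + 1) - Y (k + 1) j - Y k (j + 1) + Y k j) := by
        rw [← tel (fun k => Y k (j + 1) - Y k j) hi.1]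
        exact Finset.sum_congr rfl fun j _ => by abel
      rw [h1]
      refine (norm_sum_le _ _).trans ?_
      calc _ ≤ ∑ k ∈ Finset.Ico m i, 2 * ((α (k + 1) - α k) * (β (j + 1) - β j)) := by
            refine Finset.sum_le_sum fun k hk => ?_
            rw [Finset.mem_Ico] at hk
            exact hc k j hk.1 (hk.2.trans hi.2) hj.1 hj.2
        _ = 2 * ((α i - α m) * (β (j + 1) - β j)) := by
            rw [← Finset.mul_sum, ← Finset.sum_mul, tel α hi.1]
        _ ≤ _ := by
            have := hα hi.2.le
            have := hb0 j
            gcongr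
    have hφ : ‖Y i j - Y m n‖ ≤ (α m' - α m) + (β n' - β n) := by
      have h1 : Y i j - Y m n = (Y i j - Y m j) + (Y m j - Y m n) := by abel
      rw [h1, ← tel (fun k => Y k j) hi.1, ← tel (Y m) hj.1]
      refine (norm_add_le _ _).trans (add_le_add ?_ ?_)
      · refine (norm_sum_le _ _).trans ((Finset.sum_le_sum fun k hk => ?_).trans
          ((tel α hi.1).le.trans (sub_le_sub_right (hα hi.2.le) _)))
        rw [Finset.mem_Ico] at hk
        exact hu k j hk.1 (hk.2.trans hi.2) hj.1 hj.2.le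
      · refine (norm_sum_le _ _).trans ((Finset.sum_le_sum fun k hk => ?_).trans
          ((tel β hj.1).le.trans (sub_le_sub_right (hβ hj.2.le) _)))
        rw [Finset.mem_Ico] at hk
        exact hv m k le_rfl hm hk.1 (hk.2.trans hj.2)
    have hpu := hu i j hi.1 hi.2 hj.1 hj.2.le
    have hpu0 := hu i n hi.1 hi.2 le_rfl hn
    have hqv := hv i j hi.1 hi.2.le hj.1 hj.2
    have hdd := hd i j hi.1 hi.2 hj.1 hj.2
    have ha := ha0 i
    have hb := hb0 j
    generalize α (i + 1) - α i = a at *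
    generalize β (j + 1) - β j = b at *
    generalize α m' - α m = A at *
    generalize β n' - β n = B at *
    generalize Y (i + 1) j - Y i j = p at *
    generalize Y (i + 1) n - Y i n = p0 at *
    generalize Y i (j + 1) - Y i j = q at *
    generalize Y m (j + 1) - Y m j = q0 at *
    generalize Y i j = y at *
    generalize Y m n = y0 at *
    have hsplit : ∀ b0 : Amb d, b0 + y + (inner ℝ p0 q0 : ℝ) • y0 =
        (b0 + y + (inner ℝ p q : ℝ) • y) - ((inner ℝ (p - p0) q : ℝ) • y0 +
          (inner ℝ p0 (q - q0) : ℝ) • y0 + (inner ℝ p q : ℝ) • (y - y0)) := by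
      intro b0
      rw [inner_sub_left, inner_sub_right]
      module
    rw [hsplit]
    have e1 : ‖(inner ℝ (p - p0) q : ℝ) • y0‖ ≤ 2 * (a * B) * b := by
      rw [norm_smul, hY, mul_one]
      exact (norm_inner_le_norm _ _).trans (by gcongr)
    have e2 : ‖(inner ℝ p0 (q - q0) : ℝ) • y0‖ ≤ a * (2 * (A * b)) := by
      rw [norm_smul, hY, mul_one]
      exact (norm_inner_le_norm _ _).trans (by gcongr)
    have e3 : ‖(inner ℝ p q : ℝ) • (y - y0)‖ ≤ a * b * (A + B) := by
      rw [norm_smul]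
      have : ‖(inner ℝ p q : ℝ)‖ ≤ a * b := (norm_inner_le_norm _ _).trans (by gcongr)
      gcongr
    have e4 : 7 * (a + b) * (a * b) ≤ 7 * (A + B) * (a * b) := by gcongr
    refine (norm_sub_le _ _).trans ?_
    have := norm_add₃_le (a := (inner ℝ (p - p0) q : ℝ) • y0)
      (b := (inner ℝ p0 (q - q0) : ℝ) • y0) (c := (inner ℝ p q : ℝ) • (y - y0))
    have hfin : 2 * (a * B) * b + a * (2 * (A * b)) + a * b * (A + B) + 7 * (A + B) * (a * b) ≤
        12 * (A + B) * (a * b) := by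
      have : 0 ≤ (A + B) * (a * b) := by positivity
      nlinarith
    linarith

namespace IsDiscreteWaveMap

variable {d : ℕ} {Yp Ym : ℕ → Amb d} {Y : ℕ → ℕ → Amb d}

theorem norm_rectangle_le (h : IsDiscreteWaveMap Yp Ym Y) {α β : ℕ → ℝ} {m m' n n' : ℕ}
    (hm : m ≤ m') (hn : n ≤ n') (hα : Monotone α) (hβ : Monotone β)
    (hu : ∀ i, ‖Yp (i + 1) - Yp i‖ ≤ α (i + 1) - α i)
    (hv : ∀ j, ‖Ym (j + 1) - Ym j‖ ≤ β (j + 1) - β j)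
    (hs : ∀ i j, i < m' → j < n' → α (i + 1) - α i + (β (j + 1) - β j) ≤ 1) :
    ‖Y m' n' - Y m' n - Y m n' + Y m n‖ ≤ 2 * ((α m' - α m) * (β n' - β n)) ∧
    ‖Y m' n' - Y m' n - Y m n' + Y m n +
      (inner ℝ (Y m' n - Y m n) (Y m n' - Y m n) : ℝ) • Y m n‖ ≤
      12 * (α m' - α m + (β n' - β n)) * ((α m' - α m) * (β n' - β n)) := by
  have hu' : ∀ i j, ‖Y (i + 1) j - Y i j‖ ≤ α (i + 1) - α i :=
    fun i j => (h.norm_sub_left i j).trans_le (hu i)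
  have hv' : ∀ i j, ‖Y i (j + 1) - Y i j‖ ≤ β (j + 1) - β j :=
    fun i j => (h.norm_sub_right i j).trans_le (hv j)
  refine _root_.norm_rectangle_le hm hn hα hβ (h.norm_eq_one _ _) (fun i j _ _ _ _ => hu' i j)
    (fun i j _ _ _ _ => hv' i j) (fun i j _ hi _ hj => ?_) (fun i j _ hi _ hj => ?_)
  · rw [h.step]
    exact norm_lineReflection_sub_sub_add_le (h.norm_eq_one _ _) (h.norm_eq_one _ _)
      (h.norm_eq_one _ _) (hu' i j) (hv' i j) (hs i j hi hj)
  · rw [h.step]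
    exact norm_lineReflection_sub_sub_add_add_le (h.norm_eq_one _ _) (h.norm_eq_one _ _)
      (h.norm_eq_one _ _) (hu' i j) (hv' i j) (hs i j hi hj)

end IsDiscreteWaveMap

/-! ### Stability of the scheme -/

/-- Stability of the discrete scheme: a discrete Grönwall estimate. -/
theorem norm_sub_le_of_approx {d : ℕ} {X Y : ℕ → ℕ → Amb d} {α β : ℕ → ℝ} {M N : ℕ} {ε : ℝ}
    (hε : 0 ≤ ε) (hα : Monotone α) (hβ : Monotone β)
    (hY : ∀ i j, i ≤ M → j ≤ N → ‖Y i j‖ = 1)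
    (hXu : ∀ i j, i < M → j ≤ N → ‖X (i + 1) j - X i j‖ ≤ α (i + 1) - α i)
    (hXv : ∀ i j, i ≤ M → j < N → ‖X i (j + 1) - X i j‖ ≤ β (j + 1) - β j)
    (hYu : ∀ i j, i < M → j ≤ N → ‖Y (i + 1) j - Y i j‖ ≤ α (i + 1) - α i)
    (hYv : ∀ i j, i ≤ M → j < N → ‖Y i (j + 1) - Y i j‖ ≤ β (j + 1) - β j)
    (hX2 : ∀ i j, i < M → j < N → ‖X (i + 1) (j + 1) - X (i + 1) j - X i (j + 1) + X i j +
        (inner ℝ (X (i + 1) j - X i j) (X i (j + 1) - X i j) : ℝ) • X i j‖ ≤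
        ε * ((α (i + 1) - α i) * (β (j + 1) - β j)))
    (hY2 : ∀ i j, i < M → j < N → ‖Y (i + 1) (j + 1) - Y (i + 1) j - Y i (j + 1) + Y i j +
        (inner ℝ (Y (i + 1) j - Y i j) (Y i (j + 1) - Y i j) : ℝ) • Y i j‖ ≤
        ε * ((α (i + 1) - α i) * (β (j + 1) - β j)))
    (hl : ∀ i, i ≤ M → X i 0 = Y i 0) (hr : ∀ j, j ≤ N → X 0 j = Y 0 j)
    {i j : ℕ} (hi : i ≤ M) (hj : j ≤ N) :
    ‖X i j - Y i j‖ ≤ ε * Real.exp (5 * (α i - α 0 + (β j - β 0))) := by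
  -- The rate `5` matches the constant in `cell`: one step multiplies the weight by at least `1 + 5
  -- Δα` or `1 + 5 Δβ`, which absorbs the error of a cell.
  set w : ℕ → ℕ → ℝ := fun i j => Real.exp (5 * (α i - α 0 + (β j - β 0))) with hw
  have ha0 : ∀ i, 0 ≤ α (i + 1) - α i := fun i => sub_nonneg.mpr (hα (Nat.le_succ i))
  have hb0 : ∀ j, 0 ≤ β (j + 1) - β j := fun j => sub_nonneg.mpr (hβ (Nat.le_succ j))
  have hw1 : ∀ i j, 1 ≤ w i j := fun i j => Real.one_le_exp (by
    have := hα (Nat.zero_le i)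
    have := hβ (Nat.zero_le j)
    linarith)
  have hwu : ∀ i j, w i j * (1 + 5 * (α (i + 1) - α i)) ≤ w (i + 1) j := by
    intro i j
    have h1 : w (i + 1) j = w i j * Real.exp (5 * (α (i + 1) - α i)) := by
      simp only [hw]
      rw [← Real.exp_add]
      congr 1
      ring
    rw [h1]
    have := Real.add_one_le_exp (5 * (α (i + 1) - α i))
    have := (zero_le_one.trans (hw1 i j))
    gcongr
    linarith
  have hwv : ∀ i j, w i j * (1 + 5 * (β (j + 1) - β j)) ≤ w i (j + 1) := by
    intro i j
    have h1 : w i (j + 1) = w i j * Real.exp (5 * (β (j + 1) - β j)) := by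
      simp only [hw]
      rw [← Real.exp_add]
      congr 1
      ring
    rw [h1]
    have := Real.add_one_le_exp (5 * (β (j + 1) - β j))
    have := (zero_le_one.trans (hw1 i j))
    gcongr
    linarith
  -- The nonlinearity involves differences, so the errors of the field and of both its differences
  -- must be propagated together.
  let S : ℕ → ℕ → Prop := fun i j => i ≤ M → j ≤ N → ‖X i j - Y i j‖ ≤ ε * w i j ∧
    (i < M → ‖(X (i + 1) j - X i j) - (Y (i + 1) j - Y i j)‖ ≤ ε * w i j * (α (i + 1) - α i)) ∧
    (j < N → ‖(X i (j + 1) - X i j) - (Y i (j + 1) - Y i j)‖ ≤ ε * w i j * (β (j + 1) - β j))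
  have cell : ∀ i j, i < M → j < N → S i j →
      ‖(X (i + 1) (j + 1) - X (i + 1) j - X i (j + 1) + X i j) -
        (Y (i + 1) (j + 1) - Y (i + 1) j - Y i (j + 1) + Y i j)‖ ≤
        5 * (ε * w i j * ((α (i + 1) - α i) * (β (j + 1) - β j))) := by
    intro i j hi hj hS
    obtain ⟨h1, h2, h3⟩ := hS hi.le hj.le
    specialize h2 hi
    specialize h3 hj
    have hx := hX2 i j hi hj
    have hy := hY2 i j hi hj
    have hq := hXv i j hi.le hj
    have hp := hYu i j hi hj.le
    have hq' := hYv i j hi.le hj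
    have hp' := hXu i j hi hj.le
    have hy1 := hY i j hi.le hj.le
    have hw1' := hw1 i j
    have ha := ha0 i
    have hb := hb0 j
    generalize α (i + 1) - α i = a at *
    generalize β (j + 1) - β j = b at *
    generalize X (i + 1) (j + 1) - X (i + 1) j - X i (j + 1) + X i j = bx at *
    generalize Y (i + 1) (j + 1) - Y (i + 1) j - Y i (j + 1) + Y i j = bY at *
    generalize X (i + 1) j - X i j = p at *
    generalize Y (i + 1) j - Y i j = p' at *
    generalize X i (j + 1) - X i j = q at *
    generalize Y i (j + 1) - Y i j = q' at *
    generalize X i j = x at *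
    generalize Y i j = y at *
    generalize w i j = W at *
    have hW : 0 ≤ ε * W := mul_nonneg hε (by linarith)
    -- Two consistency errors, each at most `ε a b ≤ ε W a b` since `W ≥ 1`, and three terms from
    -- varying one factor of `(p · q) x` at a time: `2 + 3 = 5`.
    have hsplit : bx - bY = (bx + (inner ℝ p q : ℝ) • x) - (bY + (inner ℝ p' q' : ℝ) • y) -
        ((inner ℝ p q : ℝ) • (x - y) + (inner ℝ (p - p') q : ℝ) • y +
          (inner ℝ p' (q - q') : ℝ) • y) := by
      rw [inner_sub_left, inner_sub_right]
      module
    have e1 : ‖(inner ℝ p q : ℝ) • (x - y)‖ ≤ a * b * (ε * W) := by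
      rw [norm_smul]
      have : ‖(inner ℝ p q : ℝ)‖ ≤ a * b := (norm_inner_le_norm _ _).trans (by gcongr)
      gcongr
    have e2 : ‖(inner ℝ (p - p') q : ℝ) • y‖ ≤ ε * W * a * b := by
      rw [norm_smul, hy1, mul_one]
      exact (norm_inner_le_norm _ _).trans (by gcongr)
    have e3 : ‖(inner ℝ p' (q - q') : ℝ) • y‖ ≤ a * (ε * W * b) := by
      rw [norm_smul, hy1, mul_one]
      exact (norm_inner_le_norm _ _).trans (by gcongr)
    have e4 : ε * (a * b) ≤ ε * W * (a * b) := by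
      have : ε * 1 ≤ ε * W := by gcongr
      rw [mul_one] at this
      gcongr
    rw [hsplit]
    have n1 := norm_sub_le ((bx + (inner ℝ p q : ℝ) • x) - (bY + (inner ℝ p' q' : ℝ) • y))
      ((inner ℝ p q : ℝ) • (x - y) + (inner ℝ (p - p') q : ℝ) • y +
          (inner ℝ p' (q - q') : ℝ) • y)
    have n2 := norm_sub_le (bx + (inner ℝ p q : ℝ) • x) (bY + (inner ℝ p' q' : ℝ) • y)
    have n3 := norm_add₃_le (a := (inner ℝ p q : ℝ) • (x - y))
      (b := (inner ℝ (p - p') q : ℝ) • y) (c := (inner ℝ p' (q - q') : ℝ) • y)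
    linarith
  have stepu : ∀ i j, i < M → j < N → S i j →
      ‖(X (i + 1) (j + 1) - X i (j + 1)) - (Y (i + 1) (j + 1) - Y i (j + 1))‖ ≤
        ε * w i (j + 1) * (α (i + 1) - α i) := by
    intro i j hi hj hS
    have h1 := cell i j hi hj hS
    have h2 := (hS hi.le hj.le).2.1 hi
    have h3 : (X (i + 1) (j + 1) - X i (j + 1)) - (Y (i + 1) (j + 1) - Y i (j + 1)) =
      ((X (i + 1) (j + 1) - X (i + 1) j - X i (j + 1) + X i j) -
        (Y (i + 1) (j + 1) - Y (i + 1) j - Y i (j + 1) + Y i j)) +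
      ((X (i + 1) j - X i j) - (Y (i + 1) j - Y i j)) := by abel
    rw [h3]
    refine (norm_add_le _ _).trans ((add_le_add h1 h2).trans ?_)
    have h4 := mul_le_mul_of_nonneg_left (hwv i j) (mul_nonneg hε (ha0 i))
    linarith
  have stepv : ∀ i j, i < M → j < N → S i j →
      ‖(X (i + 1) (j + 1) - X (i + 1) j) - (Y (i + 1) (j + 1) - Y (i + 1) j)‖ ≤
        ε * w (i + 1) j * (β (j + 1) - β j) := by
    intro i j hi hj hS
    have h1 := cell i j hi hj hS
    have h2 := (hS hi.le hj.le).2.2 hj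
    have h3 : (X (i + 1) (j + 1) - X (i + 1) j) - (Y (i + 1) (j + 1) - Y (i + 1) j) =
      ((X (i + 1) (j + 1) - X (i + 1) j - X i (j + 1) + X i j) -
        (Y (i + 1) (j + 1) - Y (i + 1) j - Y i (j + 1) + Y i j)) +
      ((X i (j + 1) - X i j) - (Y i (j + 1) - Y i j)) := by abel
    rw [h3]
    refine (norm_add_le _ _).trans ((add_le_add h1 h2).trans ?_)
    have h4 := mul_le_mul_of_nonneg_left (hwu i j) (mul_nonneg hε (hb0 j))
    linarith
  have stepφ : ∀ i j, i < M → j ≤ N → S i j → ‖X (i + 1) j - Y (i + 1) j‖ ≤ ε * w (i + 1) j := by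
    intro i j hi hj hS
    obtain ⟨h1, h2, -⟩ := hS hi.le hj
    specialize h2 hi
    have h3 : X (i + 1) j - Y (i + 1) j =
      (X i j - Y i j) + ((X (i + 1) j - X i j) - (Y (i + 1) j - Y i j)) := by abel
    rw [h3]
    refine (norm_add_le _ _).trans ((add_le_add h1 h2).trans ?_)
    have h4 := mul_le_mul_of_nonneg_left (hwu i j) hε
    have h5 : 0 ≤ ε * w i j * (α (i + 1) - α i) :=
      mul_nonneg (mul_nonneg hε (zero_le_one.trans (hw1 i j))) (ha0 i)
    linarith
  have hεw : ∀ i j, 0 ≤ ε * w i j := fun i j => mul_nonneg hε (zero_le_one.trans (hw1 i j))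
  have main : ∀ i j, S i j := by
    intro i
    induction i with
    | zero =>
      intro j
      induction j with
      | zero =>
        intro h1 h2
        refine ⟨?_, fun h => ?_, fun h => ?_⟩
        · rw [hl 0 h1, sub_self, norm_zero]; exact hεw _ _
        · rw [hl 0 h1, hl 1 h, sub_self, norm_zero]; exact mul_nonneg (hεw _ _) (ha0 _)
        · rw [hr 0 h2, hr 1 h, sub_self, norm_zero]; exact mul_nonneg (hεw _ _) (hb0 _)
      | succ j ih =>
        intro h1 h2
        refine ⟨?_, fun h => ?_, fun h => ?_⟩
        · rw [hr _ h2, sub_self, norm_zero]; exact hεw _ _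
        · exact stepu 0 j h h2 ih
        · rw [hr _ h2, hr _ h, sub_self, norm_zero]; exact mul_nonneg (hεw _ _) (hb0 _)
    | succ i ihi =>
      intro j
      induction j with
      | zero =>
        intro h1 h2
        refine ⟨stepφ i 0 h1 h2 (ihi 0), fun h => ?_, fun h => ?_⟩
        · rw [hl _ h1, hl _ h, sub_self, norm_zero]; exact mul_nonneg (hεw _ _) (ha0 _)
        · exact stepv i 0 h1 h (ihi 0)
      | succ j ih =>
        intro h1 h2
        exact ⟨stepφ i (j + 1) h1 h2 (ihi (j + 1)), fun h => stepu (i + 1) j h h2 ih,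
          fun h => stepv i (j + 1) h1 h (ihi (j + 1))⟩
  exact (main i j hi hj).1

/-! ### Absolutely continuous curves and their primitives -/

theorem AbsolutelyContinuousOnInterval.of_dist_le {X Y : Type*} [PseudoMetricSpace X]
    [PseudoMetricSpace Y] {f : ℝ → X} {g : ℝ → Y} {a b C : ℝ}
    (hg : AbsolutelyContinuousOnInterval g a b)
    (h : ∀ x ∈ uIcc a b, ∀ y ∈ uIcc a b, dist (f x) (f y) ≤ C * dist (g x) (g y)) :
    AbsolutelyContinuousOnInterval f a b := by
  have h0 := Filter.Tendsto.const_mul C hg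
  rw [mul_zero] at h0
  refine squeeze_zero' (Eventually.of_forall fun E => Finset.sum_nonneg fun i _ => dist_nonneg)
    ?_ h0
  filter_upwards [mem_inf_of_right (mem_principal_self _)] with E hE
  rw [Finset.mul_sum]
  exact Finset.sum_le_sum fun i hi => h _ (hE.1 i hi).1 _ (hE.1 i hi).2

theorem MeasureTheory.LocallyIntegrable.intervalIntegrable' {E : Type*} [NormedAddCommGroup E]
    {f : ℝ → E} (hf : LocallyIntegrable f) (u v : ℝ) : IntervalIntegrable f volume u v :=
  intervalIntegrable_iff.mpr
    ((hf.integrableOn_isCompact isCompact_uIcc).mono_set uIoc_subset_uIcc)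

theorem MeasureTheory.LocallyIntegrable.norm' {E : Type*} [NormedAddCommGroup E]
    {f : ℝ → E} (hf : LocallyIntegrable f) : LocallyIntegrable fun x => ‖f x‖ :=
  hf.mono hf.aestronglyMeasurable.norm (Eventually.of_forall fun x => (norm_norm (f x)).le)

section

variable {E : Type*} [NormedAddCommGroup E] [NormedSpace ℝ E]

theorem MeasureTheory.LocallyIntegrable.absolutelyContinuousOnInterval_integral
    {f : ℝ → E} (hf : LocallyIntegrable f) (c a b : ℝ) :
    AbsolutelyContinuousOnInterval (fun x => ∫ t in c..x, f t) a b := by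
  have h1 := (hf.norm'.intervalIntegrable' a
    b).absolutelyContinuousOnInterval_intervalIntegral left_mem_uIcc
  refine h1.of_dist_le (C := 1) fun x _ y _ => ?_
  rw [one_mul, dist_eq_norm, dist_eq_norm,
    intervalIntegral.integral_interval_sub_left (hf.intervalIntegrable' _ _)
      (hf.intervalIntegrable' _ _),
    intervalIntegral.integral_interval_sub_left (hf.norm'.intervalIntegrable' _ _)
      (hf.norm'.intervalIntegrable' _ _)]
  exact (intervalIntegral.norm_integral_le_abs_integral_norm).trans_eq (Real.norm_eq_abs _).symm

theorem MeasureTheory.LocallyIntegrable.continuous_integral {f : ℝ → E}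
    (hf : LocallyIntegrable f) (c : ℝ) : Continuous fun x => ∫ t in c..x, f t :=
  intervalIntegral.continuous_primitive (fun a b => hf.intervalIntegrable' a b) c

/-- The difference of `f` and the primitive of `f'` is absolutely continuous with derivative zero
almost everywhere, hence constant. -/
theorem AbsolutelyContinuousOnInterval.integral_eq_sub_of_ae_hasDerivAt [CompleteSpace E]
    {f f' : ℝ → E} {a b : ℝ} (hf : AbsolutelyContinuousOnInterval f a b)
    (hf' : IntervalIntegrable f' volume a b)
    (h : ∀ᵐ x, x ∈ uIcc a b → HasDerivAt f (f' x) x)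
    (hac : AbsolutelyContinuousOnInterval (fun x => ∫ t in a..x, f' t) a b) :
    ∫ x in a..b, f' x = f b - f a := by
  have h2 := (hf.fun_sub hac).const_of_ae_hasDerivAt_zero (by
    filter_upwards [h, hf'.ae_hasDerivAt_integral] with x h1 h2 hx
    simpa using (h1 hx).fun_sub (h2 hx a left_mem_uIcc))
  obtain ⟨C, hC⟩ := h2
  have ha := hC a left_mem_uIcc
  have hb := hC b right_mem_uIcc
  simp only [intervalIntegral.integral_same, sub_zero] at ha
  rw [ha, ← hb]
  abel

/-- A function whose increments are dominated by those of a primitive is differentiable almost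
everywhere, its derivative is dominated, and it is the primitive of its derivative. -/
theorem ftc_of_dominated [FiniteDimensional ℝ E] {f : ℝ → E} {a : ℝ → ℝ}
    (ha : LocallyIntegrable a) (hf : ∀ u u', u ≤ u' → ‖f u' - f u‖ ≤ ∫ x in u..u', a x) :
    (∀ᵐ u, DifferentiableAt ℝ f u) ∧ (∀ᵐ u, ‖deriv f u‖ ≤ a u) ∧ LocallyIntegrable (deriv f) ∧
      ∀ u u', ∫ x in u..u', deriv f x = f u' - f u := by
  have : CompleteSpace E := FiniteDimensional.complete ℝ E
  have hf' : ∀ u u', ‖f u' - f u‖ ≤ |∫ x in u..u', a x| := by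
    intro u u'
    rcases le_total u u' with h | h
    · exact (hf _ _ h).trans (le_abs_self _)
    · rw [norm_sub_rev, intervalIntegral.integral_symm, abs_neg]
      exact (hf _ _ h).trans (le_abs_self _)
  have hac : ∀ p q, AbsolutelyContinuousOnInterval f p q := by
    intro p q
    refine (ha.absolutelyContinuousOnInterval_integral 0 p q).of_dist_le (C := 1)
      fun x _ y _ => ?_
    rw [one_mul, dist_eq_norm, dist_eq_norm,
      intervalIntegral.integral_interval_sub_left (ha.intervalIntegrable' _ _)
        (ha.intervalIntegrable' _ _)]
    exact hf' y x
  have h1 : ∀ᵐ u, DifferentiableAt ℝ f u := by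
    have : ∀ᵐ u, ∀ n : ℕ, u ∈ uIcc (-(n : ℝ)) n → DifferentiableAt ℝ f u :=
      ae_all_iff.mpr fun n => (hac _ _).boundedVariationOn.ae_differentiableAt_of_mem_uIcc
    filter_upwards [this] with u hu
    obtain ⟨n, hn⟩ := exists_nat_ge |u|
    refine hu n ?_
    rw [uIcc_of_le (by linarith [abs_nonneg u]), mem_Icc]
    exact abs_le.mp hn
  have h2 : ∀ᵐ u, ‖deriv f u‖ ≤ a u := by
    filter_upwards [h1, _root_.LocallyIntegrable.ae_hasDerivAt_integral ha] with u hu hau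
    -- Right difference quotients suffice: the domination of increments is stated for `u ≤ u'`, and
    -- it passes to the limit of the slopes.
    have t1 := ((hu.hasDerivAt.tendsto_slope).norm).mono_left
      (nhdsWithin_mono u (fun x (hx : x ∈ Ioi u) => (ne_of_gt hx : x ≠ u)))
    have t2 := ((hau u).tendsto_slope).mono_left
      (nhdsWithin_mono u (fun x (hx : x ∈ Ioi u) => (ne_of_gt hx : x ≠ u)))
    refine le_of_tendsto_of_tendsto t1 t2 ?_
    filter_upwards [self_mem_nhdsWithin] with x hx
    have hx' : (0 : ℝ) < x - u := sub_pos.mpr hx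
    rw [slope_def_module, slope_def_module, norm_smul, norm_inv, Real.norm_of_nonneg hx'.le,
      intervalIntegral.integral_same, sub_zero, smul_eq_mul]
    have := hf u x (le_of_lt hx)
    gcongr
  have h3 : LocallyIntegrable (deriv f) :=
    ha.mono (stronglyMeasurable_deriv f).aestronglyMeasurable (by
      filter_upwards [h2] with u hu
      exact hu.trans (le_abs_self _))
  refine ⟨h1, h2, h3, fun u u' => ?_⟩
  refine (hac u u').integral_eq_sub_of_ae_hasDerivAt (h3.intervalIntegrable' _ _) ?_
    (h3.absolutelyContinuousOnInterval_integral _ _ _)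
  filter_upwards [h1] with x hx _
  exact hx.hasDerivAt

end

/-- The derivative of a curve on `(0, ∞)`, extended by zero. -/
def velocity {d : ℕ} (f : ℝ → Amb d) : ℝ → Amb d := (Ioi (0 : ℝ)).indicator (deriv f)

theorem stronglyMeasurable_velocity {d : ℕ} (f : ℝ → Amb d) : StronglyMeasurable (velocity f) :=
  (stronglyMeasurable_deriv f).indicator measurableSet_Ioi

theorem AbsolutelyContinuousOnInterval.coord {d : ℕ} {f : ℝ → Amb d} {a b : ℝ}
    (hf : AbsolutelyContinuousOnInterval f a b) (i : Fin (d + 1)) :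
    AbsolutelyContinuousOnInterval (fun x => f x i) a b := by
  refine hf.of_dist_le (C := 1) fun x _ y _ => ?_
  rw [one_mul, dist_eq_norm, dist_eq_norm]
  exact PiLp.norm_apply_le (f x - f y) i

/-- Reduces to real-valued functions coordinate by coordinate; bounded variation gives
differentiability almost everywhere, which identifies the coordinates of the derivative. -/
theorem AbsolutelyContinuousOnInterval.ftc {d : ℕ} {f : ℝ → Amb d} {a b : ℝ}
    (hf : AbsolutelyContinuousOnInterval f a b) :
    IntervalIntegrable (deriv f) volume a b ∧ ∫ x in a..b, deriv f x = f b - f a := by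
  have hd := hf.boundedVariationOn.ae_differentiableAt_of_mem_uIcc
  have hcoord : ∀ i, ∀ᵐ x, x ∈ uIoc a b → deriv (fun x => f x i) x = deriv f x i := by
    intro i
    filter_upwards [hd] with x hx hxm
    exact (((EuclideanSpace.proj i : Amb d →L[ℝ] ℝ).hasFDerivAt.comp_hasDerivAt x
      (hx (uIoc_subset_uIcc hxm)).hasDerivAt)).deriv
  have hint : IntervalIntegrable (deriv f) volume a b := by
    rw [intervalIntegrable_iff]
    rw [IntegrableOn, ← memLp_one_iff_integrable]
    refine MemLp.of_eval_piLp fun i => ?_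
    rw [memLp_one_iff_integrable]
    refine (intervalIntegrable_iff.mp (hf.coord i).intervalIntegrable_deriv).congr ?_
    exact (ae_restrict_iff' measurableSet_uIoc).mpr (hcoord i)
  refine ⟨hint, ?_⟩
  ext i
  have h1 := (EuclideanSpace.proj i : Amb d →L[ℝ] ℝ).intervalIntegral_comp_comm hint
  rw [PiLp.sub_apply]
  refine h1.symm.trans ?_
  rw [← (hf.coord i).integral_deriv_eq_sub]
  refine intervalIntegral.integral_congr_ae ?_
  filter_upwards [hcoord i] with x hx hxm
  exact (hx hxm).symm

namespace LocallyAbsCont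

variable {d : ℕ} {f : ℝ → Amb d}

theorem integrableOn_velocity (hf : LocallyAbsCont f) (b : ℝ) :
    IntegrableOn (velocity f) (Iic b) := by
  rw [velocity, IntegrableOn, integrable_indicator_iff measurableSet_Ioi, IntegrableOn,
    Measure.restrict_restrict measurableSet_Ioi, Ioi_inter_Iic]
  rcases le_or_gt b 0 with hb | hb
  · rw [Ioc_eq_empty (by linarith)]
    simp
  · exact (intervalIntegrable_iff_integrableOn_Ioc_of_le hb.le).mp (hf b hb).ftc.1

theorem locallyIntegrable_velocity (hf : LocallyAbsCont f) : LocallyIntegrable (velocity f) := by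
  rw [locallyIntegrable_iff]
  intro k hk
  obtain ⟨b, hb⟩ := hk.bddAbove
  exact (hf.integrableOn_velocity b).mono_set fun x hx => hb hx

theorem integral_velocity (hf : LocallyAbsCont f) {u : ℝ} (hu : 0 ≤ u) :
    ∫ x in (0 : ℝ)..u, velocity f x = f u - f 0 := by
  rcases hu.eq_or_lt with rfl | hu
  · simp
  · rw [← (hf u hu).ftc.2]
    refine intervalIntegral.integral_congr_ae (Eventually.of_forall fun x hx => ?_)
    rw [uIoc_of_le hu.le] at hx
    exact indicator_of_mem (show x ∈ Ioi (0 : ℝ) from hx.1) _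

theorem norm_sub_le (hf : LocallyAbsCont f) {u u' : ℝ} (hu : 0 ≤ u) (huu' : u ≤ u') :
    ‖f u' - f u‖ ≤ ∫ x in u..u', ‖velocity f x‖ := by
  have h1 : f u' - f u = ∫ x in u..u', velocity f x := by
    rw [← intervalIntegral.integral_interval_sub_left
      (hf.locallyIntegrable_velocity.intervalIntegrable' 0 u')
      (hf.locallyIntegrable_velocity.intervalIntegrable' 0 u), hf.integral_velocity hu,
      hf.integral_velocity (hu.trans huu')]
    abel
  rw [h1]
  exact intervalIntegral.norm_integral_le_integral_norm huu'

end LocallyAbsCont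

/-! ### Controlled fields and the integral of their wave density -/

theorem ae_prod_of_ae_ae {p : ℝ × ℝ → Prop} (hm : MeasurableSet {x | p x})
    (h : ∀ᵐ w : ℝ, ∀ᵐ z : ℝ, p (w, z)) : ∀ᵐ x : ℝ × ℝ, p x := by
  rw [Measure.volume_eq_prod]
  exact (Measure.ae_prod_iff_ae_ae hm).mpr h

theorem ae_prod_of_ae_ae_swap {p : ℝ × ℝ → Prop} (hm : MeasurableSet {x | p x})
    (h : ∀ᵐ z : ℝ, ∀ᵐ w : ℝ, p (w, z)) : ∀ᵐ x : ℝ × ℝ, p x :=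
  ae_prod_of_ae_ae hm
    ((Measure.ae_ae_comm (p := fun z w => p (w, z)) (measurable_swap hm)).mp h)

theorem ae_swap {p : ℝ × ℝ → Prop} (h : ∀ᵐ x : ℝ × ℝ, p x) : ∀ᵐ x : ℝ × ℝ, p x.swap := by
  rw [Measure.volume_eq_prod] at h ⊢
  exact Measure.measurePreserving_swap.quasiMeasurePreserving.ae h

theorem ae_fst {p : ℝ → Prop} (h : ∀ᵐ x : ℝ, p x) : ∀ᵐ x : ℝ × ℝ, p x.1 := by
  rw [Measure.volume_eq_prod]
  exact Measure.quasiMeasurePreserving_fst.ae h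

theorem ae_snd {p : ℝ → Prop} (h : ∀ᵐ x : ℝ, p x) : ∀ᵐ x : ℝ × ℝ, p x.2 := by
  rw [Measure.volume_eq_prod]
  exact Measure.quasiMeasurePreserving_snd.ae h

section

variable {d : ℕ} {φ : ℝ × ℝ → Amb d}

/-- The second mixed difference of a function over the rectangle `[u, u'] × [v, v']`. -/
def mixedDiff {E : Type*} [AddCommGroup E] (φ : ℝ × ℝ → E) (u u' v v' : ℝ) : E :=
  φ (u', v') - φ (u', v) - φ (u, v') + φ (u, v)

/-- The right-hand side `(∂_u φ · ∂_v φ) φ` of the wave map equation, up to sign. -/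
def waveDensity (φ : ℝ × ℝ → Amb d) (p : ℝ × ℝ) : Amb d :=
  (inner ℝ (partialU φ p) (partialV φ p) : ℝ) • φ p

/-- Joint measurability, which continuity of the field provides, is what turns statements about
almost every point of each slice into statements almost everywhere in the plane. -/
theorem measurableSet_differentiableAt_u (hφ : Continuous φ) :
    MeasurableSet {p : ℝ × ℝ | DifferentiableAt ℝ (fun w : ℝ => φ (w, p.2)) p.1} :=
  measurable_swap (measurableSet_of_differentiableAt_with_param ℝ
    (f := fun z w : ℝ => φ (w, z)) (hφ.comp continuous_swap))

theorem measurable_partialU (hφ : Continuous φ) : Measurable (partialU φ) :=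
  (measurable_deriv_with_param (f := fun z w : ℝ => φ (w, z))
    (hφ.comp continuous_swap)).comp measurable_swap

theorem measurable_partialV (hφ : Continuous φ) : Measurable (partialV φ) :=
  measurable_deriv_with_param (f := fun w z : ℝ => φ (w, z)) hφ

theorem measurable_waveDensity (hφ : Continuous φ) : Measurable (waveDensity φ) := by
  have hm : Measurable fun p => (inner ℝ (partialU φ p) (partialV φ p) : ℝ) :=
    (measurable_partialU hφ).inner (measurable_partialV hφ)
  exact hm.smul hφ.measurable

end

/-- The increments of the sphere-valued field `φ` are dominated by the primitives of `a` and `b`,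
its mixed differences by their product. -/
structure IsControlled {d : ℕ} (a b : ℝ → ℝ) (φ : ℝ × ℝ → Amb d) : Prop where
  measurable_a : Measurable a
  measurable_b : Measurable b
  nonneg_a : ∀ x, 0 ≤ a x
  nonneg_b : ∀ x, 0 ≤ b x
  integrable_a : LocallyIntegrable a
  integrable_b : LocallyIntegrable b
  norm_eq : ∀ p, ‖φ p‖ = 1
  sub_u : ∀ u u' v, u ≤ u' → ‖φ (u', v) - φ (u, v)‖ ≤ ∫ x in u..u', a x
  sub_v : ∀ u v v', v ≤ v' → ‖φ (u, v') - φ (u, v)‖ ≤ ∫ x in v..v', b x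
  mixed : ∀ u u' v v', u ≤ u' → v ≤ v' →
    ‖mixedDiff φ u u' v v'‖ ≤ 2 * ((∫ x in u..u', a x) * ∫ x in v..v', b x)

namespace IsControlled

variable {d : ℕ} {a b : ℝ → ℝ} {φ : ℝ × ℝ → Amb d}

theorem swap (h : IsControlled a b φ) : IsControlled b a (φ ∘ Prod.swap) where
  measurable_a := h.measurable_b
  measurable_b := h.measurable_a
  nonneg_a := h.nonneg_b
  nonneg_b := h.nonneg_a
  integrable_a := h.integrable_b
  integrable_b := h.integrable_a
  norm_eq p := h.norm_eq _
  sub_u u u' v huu' := h.sub_v v u u' huu'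
  sub_v u v v' hvv' := h.sub_u v v' u hvv'
  mixed u u' v v' hu hv := by
    have := h.mixed v v' u u' hv hu
    rw [mul_comm (∫ x in u..u', b x)]
    convert! this using 2
    simp only [mixedDiff, Function.comp, Prod.swap]
    abel

theorem continuous (h : IsControlled a b φ) : Continuous φ := by
  rw [continuous_iff_continuousAt]
  rintro ⟨u, v⟩
  have habs : ∀ u' v', ‖φ (u', v') - φ (u, v)‖ ≤ |∫ x in u..u', a x| + |∫ x in v..v', b x| := by
    intro u' v'
    have h1 : ‖φ (u', v') - φ (u, v')‖ ≤ |∫ x in u..u', a x| := by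
      rcases le_total u u' with hu | hu
      · exact (h.sub_u _ _ _ hu).trans (le_abs_self _)
      · rw [norm_sub_rev, intervalIntegral.integral_symm, abs_neg]
        exact (h.sub_u _ _ _ hu).trans (le_abs_self _)
    have h2 : ‖φ (u, v') - φ (u, v)‖ ≤ |∫ x in v..v', b x| := by
      rcases le_total v v' with hv | hv
      · exact (h.sub_v _ _ _ hv).trans (le_abs_self _)
      · rw [norm_sub_rev, intervalIntegral.integral_symm, abs_neg]
        exact (h.sub_v _ _ _ hv).trans (le_abs_self _)
    calc _ = ‖(φ (u', v') - φ (u, v')) + (φ (u, v') - φ (u, v))‖ := by congr 1; abel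
      _ ≤ _ := (norm_add_le _ _).trans (add_le_add h1 h2)
  have hc : Continuous fun p : ℝ × ℝ => |∫ x in u..p.1, a x| + |∫ x in v..p.2, b x| :=
    (((h.integrable_a.continuous_integral u).comp continuous_fst).abs).add
      (((h.integrable_b.continuous_integral v).comp continuous_snd).abs)
  have ht := hc.tendsto (u, v)
  simp only [intervalIntegral.integral_same, abs_zero, add_zero] at ht
  rw [ContinuousAt, tendsto_iff_norm_sub_tendsto_zero]
  exact squeeze_zero (fun _ => norm_nonneg _) (fun p => habs p.1 p.2) ht

theorem ae_partialU (h : IsControlled a b φ) :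
    ∀ᵐ p : ℝ × ℝ, DifferentiableAt ℝ (fun w : ℝ => φ (w, p.2)) p.1 ∧ ‖partialU φ p‖ ≤ a p.1 := by
  refine ae_prod_of_ae_ae_swap ?_ (Eventually.of_forall fun z => ?_)
  · exact (measurableSet_differentiableAt_u h.continuous).inter
      (measurableSet_le (measurable_partialU h.continuous).norm (h.measurable_a.comp measurable_fst))
  · have h1 := ftc_of_dominated h.integrable_a (f := fun w => φ (w, z))
      (fun u u' huu' => h.sub_u u u' z huu')
    filter_upwards [h1.1, h1.2.1] with w hw1 hw2
    exact ⟨hw1, hw2⟩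

theorem ae_partialV (h : IsControlled a b φ) :
    ∀ᵐ p : ℝ × ℝ, DifferentiableAt ℝ (fun z : ℝ => φ (p.1, z)) p.2 ∧ ‖partialV φ p‖ ≤ b p.2 :=
  ae_swap h.swap.ae_partialU

/-- The increments of `w ↦ φ (w, z) - φ (w, v)` are mixed differences, dominated by the primitive of
`2 a ∫ b`; differentiation in `w` gives the bound. -/
theorem ae_partialU_sub (h : IsControlled a b φ) (v : ℝ) :
    ∀ᵐ p : ℝ × ℝ, v ≤ p.2 →
      ‖partialU φ p - partialU φ (p.1, v)‖ ≤ 2 * (a p.1 * ∫ x in v..p.2, b x) := by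
  refine ae_prod_of_ae_ae_swap ?_ (Eventually.of_forall fun z => ?_)
  · have hm : Measurable fun p : ℝ × ℝ => 2 * (a p.1 * ∫ x in v..p.2, b x) :=
      ((h.measurable_a.comp measurable_fst).mul
        ((h.integrable_b.continuous_integral v).measurable.comp measurable_snd)).const_mul 2
    have hm' : Measurable fun p : ℝ × ℝ => ‖partialU φ p - partialU φ (p.1, v)‖ :=
      ((measurable_partialU h.continuous).sub ((measurable_partialU h.continuous).comp
        (measurable_fst.prodMk measurable_const))).norm
    exact (measurableSet_le measurable_const measurable_snd).imp (measurableSet_le hm' hm)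
  · by_cases hz : v ≤ z
    · have h1 := ftc_of_dominated h.integrable_a (f := fun w => φ (w, z))
        (fun u u' huu' => h.sub_u u u' z huu')
      have h2 := ftc_of_dominated h.integrable_a (f := fun w => φ (w, v))
        (fun u u' huu' => h.sub_u u u' v huu')
      have hli : LocallyIntegrable fun w => (2 * ∫ x in v..z, b x) * a w :=
        h.integrable_a.smul (2 * ∫ x in v..z, b x)
      have h3 := ftc_of_dominated hli (f := fun w => φ (w, z) - φ (w, v))
        (fun u u' huu' => by
          have := h.mixed u u' v z huu' hz
          rw [intervalIntegral.integral_const_mul]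
          calc _ = ‖mixedDiff φ u u' v z‖ := by congr 1; simp only [mixedDiff]; abel
            _ ≤ _ := this
            _ = _ := by ring)
      filter_upwards [h1.1, h2.1, h3.2.1] with w hw1 hw2 hw3 _
      have : deriv (fun w => φ (w, z) - φ (w, v)) w = partialU φ (w, z) - partialU φ (w, v) :=
        deriv_fun_sub hw1 hw2
      rw [← this]
      refine hw3.trans_eq ?_
      ring
    · exact Eventually.of_forall fun w hw => absurd hw hz

theorem ae_partialV_sub (h : IsControlled a b φ) (u : ℝ) :
    ∀ᵐ p : ℝ × ℝ, u ≤ p.1 →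
      ‖partialV φ p - partialV φ (u, p.2)‖ ≤ 2 * (b p.2 * ∫ x in u..p.1, a x) :=
  ae_swap (h.swap.ae_partialU_sub u)

theorem integrableOn_bound (h : IsControlled a b φ) (u u' v v' : ℝ) :
    IntegrableOn (fun p : ℝ × ℝ => a p.1 * b p.2) (Ioc u u' ×ˢ Ioc v v') := by
  rw [IntegrableOn, Measure.volume_eq_prod, ← Measure.prod_restrict]
  exact Integrable.mul_prod
    ((h.integrable_a.integrableOn_isCompact isCompact_Icc).mono_set Ioc_subset_Icc_self)
    ((h.integrable_b.integrableOn_isCompact isCompact_Icc).mono_set Ioc_subset_Icc_self)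

theorem ae_norm_inner_le (h : IsControlled a b φ) : ∀ᵐ p : ℝ × ℝ,
    ‖(inner ℝ (partialU φ p) (partialV φ p) : ℝ)‖ ≤ a p.1 * b p.2 := by
  filter_upwards [h.ae_partialU, h.ae_partialV] with p h1 h2
  exact (norm_inner_le_norm _ _).trans
    (mul_le_mul h1.2 h2.2 (norm_nonneg _) (h.nonneg_a _))

theorem integrableOn_inner (h : IsControlled a b φ) (u u' v v' : ℝ) :
    IntegrableOn (fun p : ℝ × ℝ => (inner ℝ (partialU φ p) (partialV φ p) : ℝ))
      (Ioc u u' ×ˢ Ioc v v') :=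
  (h.integrableOn_bound u u' v v').mono'
    ((measurable_partialU h.continuous).inner
      (measurable_partialV h.continuous)).aestronglyMeasurable
    (ae_restrict_of_ae h.ae_norm_inner_le)

theorem integrableOn_waveDensity (h : IsControlled a b φ) (u u' v v' : ℝ) :
    IntegrableOn (waveDensity φ) (Ioc u u' ×ˢ Ioc v v') := by
  refine (h.integrableOn_bound u u' v v').mono'
    (measurable_waveDensity h.continuous).aestronglyMeasurable (ae_restrict_of_ae ?_)
  filter_upwards [h.ae_norm_inner_le] with p hp
  rwa [waveDensity, norm_smul, h.norm_eq, mul_one]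

end IsControlled

theorem integral_integral_eq_setIntegral {E : Type*} [NormedAddCommGroup E] [NormedSpace ℝ E]
    {G : ℝ × ℝ → E} {u u' v v' : ℝ} (hu : u ≤ u') (hv : v ≤ v')
    (hG : IntegrableOn G (Ioc u u' ×ˢ Ioc v v')) :
    ∫ w in u..u', ∫ z in v..v', G (w, z) = ∫ p in Ioc u u' ×ˢ Ioc v v', G p := by
  rw [intervalIntegral.integral_of_le hu, Measure.volume_eq_prod,
    setIntegral_prod _ (by rwa [← Measure.volume_eq_prod])]
  simp_rw [intervalIntegral.integral_of_le hv]

namespace IsControlled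

variable {d : ℕ} {a b : ℝ → ℝ} {φ : ℝ × ℝ → Amb d}

/-- By Fubini the product of the edge increments is the integral over the rectangle of `∂_u φ (w, v)
· ∂_v φ (u, z)`, the inner product of derivatives taken on the two edges through the corner. It
remains to compare this integrand, times `φ (u, v)`, pointwise with the wave density. -/
theorem norm_integral_waveDensity_sub_le (h : IsControlled a b φ) {u u' v v' : ℝ} (hu : u ≤ u')
    (hv : v ≤ v') :
    ‖(∫ w in u..u', ∫ z in v..v', waveDensity φ (w, z)) -
      (inner ℝ (φ (u', v) - φ (u, v)) (φ (u, v') - φ (u, v)) : ℝ) • φ (u, v)‖ ≤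
      3 * ((∫ x in u..u', a x) + ∫ x in v..v', b x) *
        ((∫ x in u..u', a x) * ∫ x in v..v', b x) := by
  set A := ∫ x in u..u', a x with hA
  set B := ∫ x in v..v', b x with hB
  obtain ⟨pd, pb, pi, pe⟩ := ftc_of_dominated h.integrable_a (f := fun w => φ (w, v))
      (fun u u' huu' => h.sub_u u u' v huu')
  obtain ⟨qd, qb, qi, qe⟩ := ftc_of_dominated h.integrable_b (f := fun z => φ (u, z))
      (fun v v' hvv' => h.sub_v u v v' hvv')
  set p0 : ℝ → Amb d := deriv fun w => φ (w, v) with hp0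
  set q0 : ℝ → Amb d := deriv fun z => φ (u, z) with hq0
  let G : ℝ × ℝ → Amb d := fun p => (inner ℝ (p0 p.1) (q0 p.2) : ℝ) • φ (u, v)
  have hGi : IntegrableOn G (Ioc u u' ×ˢ Ioc v v') := by
    refine (h.integrableOn_bound u u' v v').mono' ?_ (ae_restrict_of_ae ?_)
    · have hm : Measurable fun p : ℝ × ℝ => (inner ℝ (p0 p.1) (q0 p.2) : ℝ) :=
        ((measurable_deriv _).comp measurable_fst).inner ((measurable_deriv _).comp measurable_snd)
      exact (hm.smul measurable_const).aestronglyMeasurable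
    · filter_upwards [ae_fst pb, ae_snd qb] with p h1 h2
      rw [norm_smul, h.norm_eq, mul_one]
      exact (norm_inner_le_norm _ _).trans (mul_le_mul h1 h2 (norm_nonneg _) (h.nonneg_a _))
  have hGe : (inner ℝ (φ (u', v) - φ (u, v)) (φ (u, v') - φ (u, v)) : ℝ) • φ (u, v) =
      ∫ p in Ioc u u' ×ˢ Ioc v v', G p := by
    rw [← integral_integral_eq_setIntegral hu hv hGi, ← pe, ← qe]
    simp only [G, intervalIntegral.integral_smul_const]
    congr 1
    have h1 : ∀ w, ∫ z in v..v', (inner ℝ (p0 w) (q0 z) : ℝ) =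
        inner ℝ (p0 w) (∫ z in v..v', q0 z) := by
      intro w
      simp only [intervalIntegral.integral_of_le hv]
      exact integral_inner (qi.intervalIntegrable' v v').1 _
    simp_rw [h1, real_inner_comm (∫ z in v..v', q0 z), intervalIntegral.integral_of_le hu]
    refine (integral_inner (pi.intervalIntegrable' u u').1 _).symm.trans ?_
    rfl
  rw [hGe, integral_integral_eq_setIntegral hu hv (h.integrableOn_waveDensity u u' v v'),
    ← integral_sub (h.integrableOn_waveDensity u u' v v') hGi]
  have hAB : ∫ p in Ioc u u' ×ˢ Ioc v v', 3 * (A + B) * (a p.1 * b p.2) =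
      3 * (A + B) * (A * B) := by
    rw [integral_const_mul, Measure.volume_eq_prod, setIntegral_prod_mul, hA, hB,
      intervalIntegral.integral_of_le hu, intervalIntegral.integral_of_le hv]
  rw [← hAB]
  refine norm_integral_le_of_norm_le ((h.integrableOn_bound u u' v v').const_mul _) ?_
  rw [ae_restrict_iff' (measurableSet_Ioc.prod measurableSet_Ioc)]
  filter_upwards [h.ae_partialU, h.ae_partialV, h.ae_partialU_sub v, h.ae_partialV_sub u,
    ae_fst pb, ae_snd qb] with p hp hq hp' hq' hp0b hq0b hmem
  obtain ⟨w, z⟩ := p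
  obtain ⟨⟨hw1, hw2⟩, ⟨hz1, hz2⟩⟩ := hmem
  simp only at hw1 hw2 hz1 hz2 hp hq hp' hq' hp0b hq0b ⊢
  have hAle : ∫ x in u..w, a x ≤ A :=
    intervalIntegral.integral_mono_interval le_rfl hw1.le hw2
      (Eventually.of_forall h.nonneg_a) (h.integrable_a.intervalIntegrable' _ _)
  have hBle : ∫ x in v..z, b x ≤ B :=
    intervalIntegral.integral_mono_interval le_rfl hz1.le hz2
      (Eventually.of_forall h.nonneg_b) (h.integrable_b.intervalIntegrable' _ _)
  have hφd : ‖φ (w, z) - φ (u, v)‖ ≤ A + B := by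
    have h1 := h.sub_u u w z hw1.le
    have h2 := h.sub_v u v z hz1.le
    calc _ = ‖(φ (w, z) - φ (u, z)) + (φ (u, z) - φ (u, v))‖ := by congr 1; abel
      _ ≤ _ := (norm_add_le _ _).trans (by linarith)
  have hpp : ‖partialU φ (w, z) - p0 w‖ ≤ 2 * (a w * B) :=
    (hp' hz1.le).trans (by have := h.nonneg_a w; gcongr)
  have hqq : ‖partialV φ (w, z) - q0 z‖ ≤ 2 * (b z * A) :=
    (hq' hw1.le).trans (by have := h.nonneg_b z; gcongr)
  -- One factor is moved to the edges at a time, at a cost of `A + B`, `2A` and `2B` times `a b`: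
  -- the sum is `3 (A + B) a b`.
  have hsplit : waveDensity φ (w, z) - G (w, z) =
      (inner ℝ (partialU φ (w, z)) (partialV φ (w, z)) : ℝ) • (φ (w, z) - φ (u, v)) +
      (inner ℝ (partialU φ (w, z)) (partialV φ (w, z) - q0 z) : ℝ) • φ (u, v) +
      (inner ℝ (partialU φ (w, z) - p0 w) (q0 z) : ℝ) • φ (u, v) := by
    simp only [waveDensity, G]
    rw [inner_sub_left, inner_sub_right]
    module
  rw [hsplit]
  have ha := h.nonneg_a w
  have hb := h.nonneg_b z
  have hA0 : 0 ≤ A := intervalIntegral.integral_nonneg hu fun x _ => h.nonneg_a x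
  have hB0 : 0 ≤ B := intervalIntegral.integral_nonneg hv fun x _ => h.nonneg_b x
  have e1 : ‖(inner ℝ (partialU φ (w, z)) (partialV φ (w, z)) : ℝ) • (φ (w, z) - φ (u, v))‖ ≤
      a w * b z * (A + B) := by
    rw [norm_smul]
    have : ‖(inner ℝ (partialU φ (w, z)) (partialV φ (w, z)) : ℝ)‖ ≤ a w * b z :=
      (norm_inner_le_norm _ _).trans (mul_le_mul hp.2 hq.2 (norm_nonneg _) ha)
    gcongr
  have e2 : ‖(inner ℝ (partialU φ (w, z)) (partialV φ (w, z) - q0 z) : ℝ) • φ (u, v)‖ ≤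
      a w * (2 * (b z * A)) := by
    rw [norm_smul, h.norm_eq, mul_one]
    exact (norm_inner_le_norm _ _).trans (mul_le_mul hp.2 hqq (norm_nonneg _) ha)
  have e3 : ‖(inner ℝ (partialU φ (w, z) - p0 w) (q0 z) : ℝ) • φ (u, v)‖ ≤
      2 * (a w * B) * b z := by
    rw [norm_smul, h.norm_eq, mul_one]
    exact (norm_inner_le_norm _ _).trans (mul_le_mul hpp hq0b (norm_nonneg _) (by positivity))
  refine norm_add₃_le.trans ?_
  calc _ ≤ a w * b z * (A + B) + a w * (2 * (b z * A)) + 2 * (a w * B) * b z :=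
        add_le_add (add_le_add e1 e2) e3
    _ = _ := by ring

end IsControlled

/-! ### Additivity of mixed differences over subdivisions -/

theorem sum_mixedDiff {E : Type*} [AddCommGroup E] (D : ℝ × ℝ → E) (x y : ℕ → ℝ) (m n : ℕ) :
    ∑ i ∈ Finset.range m, ∑ j ∈ Finset.range n, mixedDiff D (x i) (x (i + 1)) (y j) (y (j + 1)) =
      mixedDiff D (x 0) (x m) (y 0) (y n) := by
  have h1 : ∀ i, ∑ j ∈ Finset.range n, mixedDiff D (x i) (x (i + 1)) (y j) (y (j + 1)) =
      (D (x (i + 1), y n) - D (x (i + 1), y 0)) - (D (x i, y n) - D (x i, y 0)) := by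
    intro i
    rw [← Finset.sum_range_sub (fun j => D (x (i + 1), y j)),
      ← Finset.sum_range_sub (fun j => D (x i, y j)), ← Finset.sum_sub_distrib]
    exact Finset.sum_congr rfl fun j _ => by simp only [mixedDiff]; abel
  rw [Finset.sum_congr rfl fun i _ => h1 i,
    Finset.sum_range_sub (fun i => D (x i, y n) - D (x i, y 0))]
  simp only [mixedDiff]
  abel

theorem exists_modulus {α : ℝ → ℝ} (hα : Continuous α) (U : ℝ) {ε : ℝ} (hε : 0 < ε) :
    ∃ δ > 0, ∀ x ∈ Icc 0 U, ∀ y ∈ Icc 0 U, |x - y| < δ → |α x - α y| < ε := by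
  have h := (isCompact_Icc (a := (0 : ℝ)) (b := U)).uniformContinuousOn_of_continuous
    hα.continuousOn
  simp only [Metric.uniformContinuousOn_iff, Real.dist_eq] at h
  exact h ε hε

theorem nonpos_of_forall_le_mul {x K : ℝ} (h : ∀ ε > 0, x ≤ ε * K) : x ≤ 0 := by
  have ht : Tendsto (fun ε : ℝ => ε * K) (𝓝[>] 0) (𝓝 (0 * K)) :=
    ((continuous_id.mul continuous_const).tendsto 0).mono_left nhdsWithin_le_nhds
  rw [zero_mul] at ht
  exact ge_of_tendsto ht (by filter_upwards [self_mem_nhdsWithin] with ε hε using h ε hε)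

/-- A mixed difference which is of third order on small rectangles vanishes, by additivity. -/
theorem mixedDiff_eq_zero {E : Type*} [NormedAddCommGroup E] {D : ℝ × ℝ → E} {α β : ℝ → ℝ} {C : ℝ}
    (hC : 0 ≤ C)
    (hα : Continuous α) (hβ : Continuous β) (hαm : Monotone α) (hβm : Monotone β)
    (h : ∀ u u' v v', 0 ≤ u → u ≤ u' → 0 ≤ v → v ≤ v' → ‖mixedDiff D u u' v v'‖ ≤
      C * (α u' - α u + (β v' - β v)) * ((α u' - α u) * (β v' - β v)))
    {u v : ℝ} (hu : 0 ≤ u) (hv : 0 ≤ v) : mixedDiff D 0 u 0 v = 0 := by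
  rw [← norm_le_zero_iff]
  refine nonpos_of_forall_le_mul (K := C * 2 * ((α u - α 0) * (β v - β 0))) fun ε hε => ?_
  obtain ⟨δ, hδ, hδα⟩ := exists_modulus hα u hε
  obtain ⟨δ', hδ', hδβ⟩ := exists_modulus hβ v hε
  -- A subdivision into equal parts fine enough that `γ` grows by at most `ε` on each. With one for
  -- each variable, the third order bound gains a factor `2ε` on every cell.
  have partition : ∀ {s : ℝ} {γ : ℝ → ℝ} {η : ℝ}, 0 ≤ s →
      (∀ x ∈ Icc 0 s, ∀ y ∈ Icc 0 s, |x - y| < η → |γ x - γ y| < ε) → 0 < η →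
      ∃ (n : ℕ) (x : ℕ → ℝ), Monotone x ∧ x 0 = 0 ∧ x n = s ∧
        ∀ i < n, γ (x (i + 1)) - γ (x i) ≤ ε := by
    intro s γ η hs hγ hη
    obtain ⟨n, hn⟩ := exists_nat_gt (s / η)
    have hn0 : (0 : ℝ) < n := (div_nonneg hs hη.le).trans_lt hn
    have hmono : Monotone fun i : ℕ => s * i / n := fun i j hij => by
      have : (i : ℝ) ≤ j := by exact_mod_cast hij
      change s * i / n ≤ s * j / n
      gcongr
    have hend : s * n / n = s := mul_div_cancel_right₀ s hn0.ne'
    refine ⟨n, fun i => s * i / n, hmono, by simp, hend, fun i hi => ?_⟩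
    refine (le_abs_self _).trans (hγ _ ⟨?_, ?_⟩ _ ⟨?_, ?_⟩ ?_).le
    · positivity
    · exact (hmono (Nat.succ_le_of_lt hi)).trans_eq hend
    · positivity
    · exact (hmono hi.le).trans_eq hend
    · have : s * ((i + 1 : ℕ) : ℝ) / n - s * i / n = s / n := by push_cast; ring
      rw [this, abs_of_nonneg (by positivity), div_lt_iff₀ hn0, mul_comm]
      exact (div_lt_iff₀ hη).mp hn
  obtain ⟨m, x, hx, hx0, hxm, hxα⟩ := partition hu hδα hδ
  obtain ⟨n, y, hy, hy0, hyn, hyβ⟩ := partition hv hδβ hδ'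
  have hsum := sum_mixedDiff D x y m n
  rw [hx0, hxm, hy0, hyn] at hsum
  have hAB : ∑ i ∈ Finset.range m, ∑ j ∈ Finset.range n,
      (α (x (i + 1)) - α (x i)) * (β (y (j + 1)) - β (y j)) = (α u - α 0) * (β v - β 0) := by
    rw [← Finset.sum_mul_sum, Finset.sum_range_sub (fun i => α (x i)),
      Finset.sum_range_sub (fun j => β (y j)), hx0, hxm, hy0, hyn]
  rw [← hsum, ← hAB, Finset.mul_sum, Finset.mul_sum]
  refine (norm_sum_le _ _).trans (Finset.sum_le_sum fun i hi => ?_)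
  rw [Finset.mul_sum, Finset.mul_sum]
  refine (norm_sum_le _ _).trans (Finset.sum_le_sum fun j hj => ?_)
  rw [Finset.mem_range] at hi hj
  have hxi := hx (Nat.le_succ i)
  have hyj := hy (Nat.le_succ j)
  have ha : 0 ≤ α (x (i + 1)) - α (x i) := sub_nonneg.mpr (hαm hxi)
  have hb : 0 ≤ β (y (j + 1)) - β (y j) := sub_nonneg.mpr (hβm hyj)
  refine (h _ _ _ _ (hx0 ▸ hx (Nat.zero_le i)) hxi (hy0 ▸ hy (Nat.zero_le j)) hyj).trans ?_
  have h1 : α (x (i + 1)) - α (x i) + (β (y (j + 1)) - β (y j)) ≤ 2 * ε := by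
    linarith [hxα i hi, hyβ j hj]
  calc _ ≤ C * (2 * ε) * ((α (x (i + 1)) - α (x i)) * (β (y (j + 1)) - β (y j))) := by gcongr
    _ = _ := by ring

/-! ### The Goursat problem and conservation of energy -/

/-- The solution of the Goursat problem `∂_u ∂_v ψ = -F` with `∂_u ψ = P` on `{v = 0}` and
`∂_v ψ = Q` on `{u = 0}`. -/
def goursat {d : ℕ} (c : Amb d) (P Q : ℝ → Amb d) (F : ℝ × ℝ → Amb d) (p : ℝ × ℝ) : Amb d :=
  c + (∫ w in (0 : ℝ)..p.1, P w) + (∫ z in (0 : ℝ)..p.2, Q z) -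
    ∫ w in (0 : ℝ)..p.1, ∫ z in (0 : ℝ)..p.2, F (w, z)

/-- The derivative `∂_u` of the solution of the Goursat problem. -/
def goursatU {d : ℕ} (P : ℝ → Amb d) (F : ℝ × ℝ → Amb d) (p : ℝ × ℝ) : Amb d :=
  P p.1 - ∫ z in (0 : ℝ)..p.2, F (p.1, z)

section

variable {d : ℕ} {c : Amb d} {P Q : ℝ → Amb d} {F : ℝ × ℝ → Amb d}

theorem integrable_swap_volume (hF : Integrable F) : Integrable (F ∘ Prod.swap) := by
  rw [Measure.volume_eq_prod] at hF ⊢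
  exact hF.swap

theorem goursat_swap (hF : Integrable F) :
    goursat c P Q F ∘ Prod.swap = goursat c Q P (F ∘ Prod.swap) := by
  funext p
  simp only [goursat, Function.comp, Prod.swap]
  rw [intervalIntegral_intervalIntegral_swap (F := fun w z => F (w, z)) hF.integrableOn]
  abel

theorem integrable_integral_slice (hF : Integrable F) (v v' : ℝ) :
    Integrable fun w => ∫ z in v..v', F (w, z) := by
  have h : ∀ s : Set ℝ, Integrable fun w => ∫ z in s, F (w, z) := by
    intro s
    have h1 : Integrable F (volume.prod (volume.restrict s)) := by
      have h2 := hF.integrableOn (s := univ ×ˢ s)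
      rw [IntegrableOn, Measure.volume_eq_prod, ← Measure.prod_restrict, Measure.restrict_univ]
        at h2
      exact h2
    exact h1.integral_prod_left
  simp only [intervalIntegral]
  exact (h _).sub (h _)

theorem ae_integrable_slice (hF : Integrable F) : ∀ᵐ w : ℝ, Integrable fun z => F (w, z) := by
  rw [Measure.volume_eq_prod] at hF
  exact hF.prod_right_ae

theorem ae_hasDerivAt_goursat (hP : LocallyIntegrable P) (hF : Integrable F) (v : ℝ) :
    ∀ᵐ u : ℝ, HasDerivAt (fun w => goursat c P Q F (w, v)) (goursatU P F (u, v)) u := by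
  have hg := (integrable_integral_slice hF 0 v).locallyIntegrable
  filter_upwards [_root_.LocallyIntegrable.ae_hasDerivAt_integral hP,
    _root_.LocallyIntegrable.ae_hasDerivAt_integral hg] with u h1 h2
  exact (((h1 0).const_add c).add_const (∫ z in (0 : ℝ)..v, Q z)).fun_sub (h2 0)

theorem goursat_sub (hP : LocallyIntegrable P) (hF : Integrable F) (u u' v : ℝ) :
    goursat c P Q F (u', v) - goursat c P Q F (u, v) = ∫ w in u..u', goursatU P F (w, v) := by
  have hg := (integrable_integral_slice hF 0 v).locallyIntegrable
  simp only [goursatU]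
  rw [intervalIntegral.integral_sub (hP.intervalIntegrable' _ _) (hg.intervalIntegrable' _ _),
    ← intervalIntegral.integral_interval_sub_left (hP.intervalIntegrable' 0 u')
      (hP.intervalIntegrable' 0 u),
    ← intervalIntegral.integral_interval_sub_left (hg.intervalIntegrable' 0 u')
      (hg.intervalIntegrable' 0 u)]
  simp only [goursat]
  abel

/-- Moving a corner changes the double integral by at most the increment of the primitive of a
marginal of `|F|`. Continuity is needed to make the partial derivatives measurable. -/
theorem continuous_goursat (hP : LocallyIntegrable P) (hQ : LocallyIntegrable Q)
    (hF : Integrable F) : Continuous (goursat c P Q F) := by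
  have hG : ∀ {F : ℝ × ℝ → Amb d}, Integrable F → Integrable fun w => ∫ z, ‖F (w, z)‖ := by
    intro F hF
    rw [Measure.volume_eq_prod] at hF
    exact hF.norm.integral_prod_left
  have hJ : ∀ {F : ℝ × ℝ → Amb d}, Integrable F → ∀ u u' v,
      ‖∫ w in u..u', ∫ z in (0 : ℝ)..v, F (w, z)‖ ≤ |∫ w in u..u', ∫ z, ‖F (w, z)‖| := by
    intro F hF u u' v
    refine intervalIntegral.norm_integral_le_abs_of_norm_le ?_
      ((hG hF).locallyIntegrable.intervalIntegrable' u u')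
    refine ae_restrict_of_ae ?_
    filter_upwards [ae_integrable_slice hF] with w hw
    refine intervalIntegral.norm_integral_le_integral_norm_uIoc.trans ?_
    exact setIntegral_le_integral hw.norm (Eventually.of_forall fun _ => norm_nonneg _)
  have hJc : Continuous fun p : ℝ × ℝ => ∫ w in (0 : ℝ)..p.1, ∫ z in (0 : ℝ)..p.2, F (w, z) := by
    rw [continuous_iff_continuousAt]
    rintro ⟨u, v⟩
    have hF' := integrable_swap_volume hF
    have hb : ∀ p : ℝ × ℝ, ‖(∫ w in (0 : ℝ)..p.1, ∫ z in (0 : ℝ)..p.2, F (w, z)) -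
        ∫ w in (0 : ℝ)..u, ∫ z in (0 : ℝ)..v, F (w, z)‖ ≤ |∫ w in u..p.1, ∫ z, ‖F (w, z)‖| +
          |∫ z in v..p.2, ∫ w, ‖F (w, z)‖| := by
      rintro ⟨u', v'⟩
      have e1 : (∫ w in (0 : ℝ)..u', ∫ z in (0 : ℝ)..v', F (w, z)) -
          ∫ w in (0 : ℝ)..u, ∫ z in (0 : ℝ)..v', F (w, z) =
          ∫ w in u..u', ∫ z in (0 : ℝ)..v', F (w, z) :=
        intervalIntegral.integral_interval_sub_left
          ((integrable_integral_slice hF 0 v').locallyIntegrable.intervalIntegrable' _ _)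
          ((integrable_integral_slice hF 0 v').locallyIntegrable.intervalIntegrable' _ _)
      have e2 : (∫ w in (0 : ℝ)..u, ∫ z in (0 : ℝ)..v', F (w, z)) -
          ∫ w in (0 : ℝ)..u, ∫ z in (0 : ℝ)..v, F (w, z) =
          ∫ z in v..v', ∫ w in (0 : ℝ)..u, F (w, z) := by
        rw [intervalIntegral_intervalIntegral_swap (F := fun w z => F (w, z)) hF.integrableOn,
          intervalIntegral_intervalIntegral_swap (F := fun w z => F (w, z)) hF.integrableOn]
        exact intervalIntegral.integral_interval_sub_left
          ((integrable_integral_slice hF' 0 u).locallyIntegrable.intervalIntegrable' _ _)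
          ((integrable_integral_slice hF' 0 u).locallyIntegrable.intervalIntegrable' _ _)
      rw [← sub_add_sub_cancel _ (∫ w in (0 : ℝ)..u, ∫ z in (0 : ℝ)..v', F (w, z)), e1, e2]
      exact (norm_add_le _ _).trans (add_le_add (hJ hF _ _ _) (hJ hF' _ _ _))
    have hc : Continuous fun p : ℝ × ℝ => |∫ w in u..p.1, ∫ z, ‖F (w, z)‖| +
          |∫ z in v..p.2, ∫ w, ‖F (w, z)‖| :=
      ((((hG hF).locallyIntegrable.continuous_integral u).comp continuous_fst).abs).add
        ((((hG hF').locallyIntegrable.continuous_integral v).comp continuous_snd).abs)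
    have ht := hc.tendsto (u, v)
    simp only [intervalIntegral.integral_same, abs_zero, add_zero] at ht
    rw [ContinuousAt, tendsto_iff_norm_sub_tendsto_zero]
    exact squeeze_zero (fun _ => norm_nonneg _) hb ht
  exact ((continuous_const.add ((hP.continuous_integral 0).comp continuous_fst)).add
    ((hQ.continuous_integral 0).comp continuous_snd)).sub hJc

/-- The integral with a moving endpoint is a difference of two integrals over the whole line, with
indicators of `0 < z ≤ v` and `v < z ≤ 0`; parametrized integrals are measurable. -/
theorem stronglyMeasurable_goursatU (hP : StronglyMeasurable P) (hF : StronglyMeasurable F) :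
    StronglyMeasurable (goursatU P F) := by
  have h : ∀ s : Set (ℝ × ℝ), MeasurableSet s →
      StronglyMeasurable fun p : ℝ × ℝ => ∫ z, s.indicator (fun _ => F (p.1, z)) (p.2, z) := by
    intro s hs
    refine StronglyMeasurable.integral_prod_right
      (f := fun (p : ℝ × ℝ) (z : ℝ) => s.indicator (fun _ => F (p.1, z)) (p.2, z)) ?_
    have h1 : StronglyMeasurable fun q : (ℝ × ℝ) × ℝ => F (q.1.1, q.2) :=
      hF.comp_measurable (by fun_prop)
    have h2 : MeasurableSet {q : (ℝ × ℝ) × ℝ | (q.1.2, q.2) ∈ s} :=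
      (show Measurable fun q : (ℝ × ℝ) × ℝ => (q.1.2, q.2) by fun_prop) hs
    exact h1.indicator h2
  have hs1 : MeasurableSet {q : ℝ × ℝ | 0 < q.2 ∧ q.2 ≤ q.1} :=
    (measurableSet_lt measurable_const measurable_snd).inter
      (measurableSet_le measurable_snd measurable_fst)
  have hs2 : MeasurableSet {q : ℝ × ℝ | q.1 < q.2 ∧ q.2 ≤ 0} :=
    (measurableSet_lt measurable_fst measurable_snd).inter
      (measurableSet_le measurable_snd measurable_const)
  refine (hP.comp_measurable measurable_fst).sub ?_
  convert! (h _ hs1).sub (h _ hs2) using 1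
  funext p
  simp only [intervalIntegral, Pi.sub_apply]
  rw [← integral_indicator measurableSet_Ioc, ← integral_indicator measurableSet_Ioc]
  rfl

theorem ae_partialU_goursat (hP : LocallyIntegrable P) (hQ : LocallyIntegrable Q)
    (hPm : StronglyMeasurable P) (hF : Integrable F) (hFm : StronglyMeasurable F) :
    ∀ᵐ p : ℝ × ℝ, DifferentiableAt ℝ (fun w => goursat c P Q F (w, p.2)) p.1 ∧
      partialU (goursat c P Q F) p = goursatU P F p := by
  have hc := continuous_goursat (c := c) hP hQ hF
  refine ae_prod_of_ae_ae_swap ?_ (Eventually.of_forall fun v => ?_)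
  · exact (measurableSet_differentiableAt_u hc).inter (measurableSet_eq_fun
      (measurable_partialU hc) (stronglyMeasurable_goursatU hPm hFm).measurable)
  · filter_upwards [ae_hasDerivAt_goursat (c := c) (Q := Q) hP hF v] with u hu
    exact ⟨hu.differentiableAt, hu.deriv⟩

/-- Conservation of energy: `|∂_u ψ|` does not depend on `v` if `∂_v ∂_u ψ` is orthogonal
to `∂_u ψ`. -/
theorem norm_goursatU_eq (hF : Integrable F)
    (h : ∀ᵐ p : ℝ × ℝ, (inner ℝ (F p) (goursatU P F p) : ℝ) = 0) :
    ∀ᵐ u : ℝ, ∀ v, ‖goursatU P F (u, v)‖ = ‖P u‖ := by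
  have h' : ∀ᵐ u : ℝ, ∀ᵐ v : ℝ, (inner ℝ (F (u, v)) (goursatU P F (u, v)) : ℝ) = 0 := by
    rw [Measure.volume_eq_prod] at h
    exact Measure.ae_ae_of_ae_prod h
  filter_upwards [h', ae_integrable_slice hF] with u hu hFu v
  have hli := hFu.locallyIntegrable
  have hac : AbsolutelyContinuousOnInterval (fun z => goursatU P F (u, z)) 0 v := by
    refine (hli.absolutelyContinuousOnInterval_integral 0 0 v).of_dist_le (C := 1)
      fun x _ y _ => ?_
    rw [one_mul]
    exact (dist_sub_left _ _ _).le
  -- On this slice `||x|² - |y|²| ≤ 2M |x - y|`, so the squared norm is absolutely continuous. Its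
  -- derivative `-2 F · goursatU` vanishes almost everywhere, so it is constant in every `v`, not
  -- just almost every `v`.
  obtain ⟨M, hM⟩ := hac.exists_bound
  have hac2 : AbsolutelyContinuousOnInterval (fun z => ‖goursatU P F (u, z)‖ ^ 2) 0 v := by
    refine hac.of_dist_le (C := 2 * M) fun x hx y hy => ?_
    rw [Real.dist_eq, dist_eq_norm, sq_sub_sq, abs_mul]
    have h1 := hM x hx
    have h2 := hM y hy
    have h3 : |‖goursatU P F (u, x)‖ + ‖goursatU P F (u, y)‖| ≤ 2 * M := by
      rw [abs_of_nonneg (by positivity)]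
      linarith
    exact mul_le_mul h3 (abs_norm_sub_norm_le _ _) (abs_nonneg _) ((abs_nonneg _).trans h3)
  obtain ⟨C, hC⟩ := hac2.const_of_ae_hasDerivAt_zero (by
    filter_upwards [hu, _root_.LocallyIntegrable.ae_hasDerivAt_integral hli] with z hz hd _
    have h1 : HasDerivAt (fun z => goursatU P F (u, z)) (-F (u, z)) z :=
      (hd 0).const_sub (P u)
    have h2 := h1.norm_sq
    rwa [inner_neg_right, real_inner_comm, hz, neg_zero, mul_zero] at h2)
  have h0 := hC 0 left_mem_uIcc
  have hv := hC v right_mem_uIcc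
  have hsq : ‖goursatU P F (u, v)‖ ^ 2 = ‖P u‖ ^ 2 := by
    rw [hv, ← h0]
    simp [goursatU]
  exact (sq_eq_sq₀ (norm_nonneg _) (norm_nonneg _)).mp hsq

end

/-! ### A priori estimates for arbitrary wave maps -/

namespace IsWaveMapOn

variable {d : ℕ} {u₀ v₀ : ℝ} {φp φm : ℝ → Amb d} {ψ : ℝ × ℝ → Amb d}

theorem norm_eq (h : IsWaveMapOn u₀ v₀ φp φm ψ) {u v : ℝ} (hu : u ∈ Icc 0 u₀)
    (hv : v ∈ Icc 0 v₀) : ‖ψ (u, v)‖ = 1 :=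
  mem_sphere_zero_iff_norm.mp (h.mem_sphere _ ⟨hu, hv⟩)

theorem integrableOn_waveDensity (h : IsWaveMapOn u₀ v₀ φp φm ψ) :
    IntegrableOn (waveDensity ψ) (Icc 0 u₀ ×ˢ Icc 0 v₀) := by
  refine h.integrable_inner.norm.mono'
    (h.integrable_inner.aestronglyMeasurable.smul h.aestronglyMeasurable) ?_
  rw [ae_restrict_iff' (measurableSet_Icc.prod measurableSet_Icc)]
  refine Eventually.of_forall fun p hp => ?_
  rw [waveDensity, norm_smul, h.norm_eq hp.1 hp.2, mul_one]

theorem swap (h : IsWaveMapOn u₀ v₀ φp φm ψ) (h0 : φp 0 = φm 0) :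
    IsWaveMapOn v₀ u₀ φm φp (ψ ∘ Prod.swap) := by
  have hmp : MeasurePreserving (Prod.swap : ℝ × ℝ → ℝ × ℝ)
      (volume.restrict (Icc 0 v₀ ×ˢ Icc 0 u₀)) (volume.restrict (Icc 0 u₀ ×ˢ Icc 0 v₀)) := by
    simp only [Measure.volume_eq_prod, ← Measure.prod_restrict]
    exact Measure.measurePreserving_swap
  refine ⟨fun p hp => h.mem_sphere _ ⟨hp.2, hp.1⟩, ?_, ?_, ?_, ?_, ?_⟩
  · exact h.aestronglyMeasurable.comp_measurePreserving hmp
  · exact hmp.quasiMeasurePreserving.ae h.differentiable_v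
  · exact hmp.quasiMeasurePreserving.ae h.differentiable_u
  · have := hmp.integrable_comp_of_integrable h.integrable_inner
    refine this.congr (Eventually.of_forall fun p => ?_)
    exact real_inner_comm _ _
  · intro u hu v hv
    have hi : IntegrableOn (fun p : ℝ × ℝ => waveDensity ψ p) (uIoc 0 v ×ˢ uIoc 0 u) := by
      refine h.integrableOn_waveDensity.mono_set (prod_mono ?_ ?_)
      · rw [uIoc_of_le hv.1]; exact fun x hx => ⟨hx.1.le, hx.2.trans hv.2⟩
      · rw [uIoc_of_le hu.1]; exact fun x hx => ⟨hx.1.le, hx.2.trans hu.2⟩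
    have h1 := h.integral_eq v hv u hu
    have h2 := intervalIntegral_intervalIntegral_swap
      (F := fun w z => waveDensity ψ (w, z)) hi
    simp only [waveDensity] at h2
    rw [h2] at h1
    change ψ (v, u) = _
    rw [h1, h0, add_comm (φp v)]
    congr 1
    refine intervalIntegral.integral_congr fun w _ =>
      intervalIntegral.integral_congr fun z _ => ?_
    change (inner ℝ (partialU ψ (z, w)) (partialV ψ (z, w)) : ℝ) • ψ (z, w) =
      (inner ℝ (partialV ψ (z, w)) (partialU ψ (z, w)) : ℝ) • ψ (z, w)
    rw [real_inner_comm]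

/-- A wave map on a rectangle solves a Goursat problem with globally defined data, and the
right-hand side is orthogonal to its derivative. -/
theorem exists_goursat (h : IsWaveMapOn u₀ v₀ φp φm ψ) (hp : LocallyAbsCont φp)
    (hm : LocallyAbsCont φm) (h0 : φp 0 = φm 0) :
    ∃ F : ℝ × ℝ → Amb d, StronglyMeasurable F ∧ Integrable F ∧
      (∀ u ∈ Icc 0 u₀, ∀ v ∈ Icc 0 v₀,
        ψ (u, v) = goursat (φp 0) (velocity φp) (velocity φm) F (u, v)) ∧
      F =ᵐ[volume] (Ioc 0 u₀ ×ˢ Ioc 0 v₀).indicator (waveDensity ψ) := by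
  have hms : MeasurableSet (Ioc 0 u₀ ×ˢ Ioc 0 v₀ : Set (ℝ × ℝ)) :=
    measurableSet_Ioc.prod measurableSet_Ioc
  have hi : Integrable ((Ioc 0 u₀ ×ˢ Ioc 0 v₀).indicator (waveDensity ψ)) :=
    (integrable_indicator_iff hms).mpr (h.integrableOn_waveDensity.mono_set
      (prod_mono Ioc_subset_Icc_self Ioc_subset_Icc_self))
  -- The density is known only up to almost everywhere equality to be measurable, so `F` is a
  -- strongly measurable representative of its restriction to the rectangle, extended by zero.
  refine ⟨hi.1.mk _, hi.1.stronglyMeasurable_mk, hi.congr hi.1.ae_eq_mk, ?_, hi.1.ae_eq_mk.symm⟩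
  intro u hu v hv
  have e1 : ∫ w in (0 : ℝ)..u, ∫ z in (0 : ℝ)..v,
      (inner ℝ (partialU ψ (w, z)) (partialV ψ (w, z)) : ℝ) • ψ (w, z) =
      ∫ w in (0 : ℝ)..u, ∫ z in (0 : ℝ)..v, hi.1.mk _ (w, z) := by
    have hsub : Ioc 0 u ×ˢ Ioc 0 v ⊆ Ioc 0 u₀ ×ˢ Ioc 0 v₀ :=
      prod_mono (Ioc_subset_Ioc_right hu.2) (Ioc_subset_Ioc_right hv.2)
    have hsub' : Ioc 0 u ×ˢ Ioc 0 v ⊆ Icc 0 u₀ ×ˢ Icc 0 v₀ :=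
      hsub.trans (prod_mono Ioc_subset_Icc_self Ioc_subset_Icc_self)
    rw [integral_integral_eq_setIntegral hu.1 hv.1
      (hi.congr hi.1.ae_eq_mk).integrableOn]
    refine (integral_integral_eq_setIntegral (G := waveDensity ψ) hu.1 hv.1
      (h.integrableOn_waveDensity.mono_set hsub')).trans ?_
    refine integral_congr_ae ?_
    rw [EventuallyEq, ae_restrict_iff' (measurableSet_Ioc.prod measurableSet_Ioc)]
    filter_upwards [hi.1.ae_eq_mk] with p hp hpm
    rw [← hp, indicator_of_mem (hsub hpm)]
  rw [h.integral_eq u hu v hv, goursat, e1, hp.integral_velocity hu.1, hm.integral_velocity hv.1,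
    ← h0]
  abel

end IsWaveMapOn

section

variable {d : ℕ} {c : Amb d} {P Q : ℝ → Amb d} {F ψ : ℝ × ℝ → Amb d} {u₀ v₀ : ℝ}

/-- Nothing is known about `ψ` beyond `u₀`, so a two-sided derivative needs `p.1 < u₀`; the
discarded line is a null set. In `v` no neighbourhood is needed. -/
theorem ae_hasDerivAt_of_eq_goursat (hP : LocallyIntegrable P) (hQ : LocallyIntegrable Q)
    (hPm : StronglyMeasurable P) (hF : Integrable F) (hFm : StronglyMeasurable F)
    (hψ : ∀ u ∈ Icc 0 u₀, ∀ v ∈ Icc 0 v₀, ψ (u, v) = goursat c P Q F (u, v)) :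
    ∀ᵐ p : ℝ × ℝ, p ∈ Ioc 0 u₀ ×ˢ Ioc 0 v₀ → p.1 < u₀ ∧
      HasDerivAt (fun w => ψ (w, p.2)) (goursatU P F p) p.1 := by
  have hne : ∀ᵐ x : ℝ, x ≠ u₀ := by simp [ae_iff, measure_singleton]
  filter_upwards [ae_fst hne, ae_partialU_goursat (c := c) hP hQ hPm hF hFm] with p hp1 hp2 hmem
  have hlt := lt_of_le_of_ne hmem.1.2 hp1
  refine ⟨hlt, ?_⟩
  have h1 : HasDerivAt (fun w => goursat c P Q F (w, p.2)) (goursatU P F p) p.1 := by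
    rw [← hp2.2]
    exact hp2.1.hasDerivAt
  refine h1.congr_of_eventuallyEq ?_
  filter_upwards [Ioo_mem_nhds hmem.1.1 hlt] with w hw
  exact hψ w ⟨hw.1.le, hw.2.le⟩ p.2 ⟨hmem.2.1.le, hmem.2.2⟩

/-- Differentiating `|ψ|² = 1` gives `ψ · ∂_u ψ = 0`. As `F` is a multiple of `ψ`, it is orthogonal
to `∂_u ψ` and energy is conserved. -/
theorem ae_norm_goursatU_eq (hP : LocallyIntegrable P) (hQ : LocallyIntegrable Q)
    (hPm : StronglyMeasurable P) (hF : Integrable F) (hFm : StronglyMeasurable F)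
    (hψ : ∀ u ∈ Icc 0 u₀, ∀ v ∈ Icc 0 v₀, ψ (u, v) = goursat c P Q F (u, v))
    (hn : ∀ u ∈ Icc 0 u₀, ∀ v ∈ Icc 0 v₀, ‖ψ (u, v)‖ = 1) {K : ℝ × ℝ → ℝ}
    (hK : F =ᵐ[volume] (Ioc 0 u₀ ×ˢ Ioc 0 v₀).indicator fun p => K p • ψ p) :
    ∀ᵐ u : ℝ, ∀ v, ‖goursatU P F (u, v)‖ = ‖P u‖ := by
  refine norm_goursatU_eq hF ?_
  filter_upwards [hK, ae_hasDerivAt_of_eq_goursat hP hQ hPm hF hFm hψ] with p hp hd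
  by_cases hmem : p ∈ Ioc 0 u₀ ×ˢ Ioc 0 v₀
  · obtain ⟨hlt, hd⟩ := hd hmem
    have h1 := hd.norm_sq
    have h2 : HasDerivAt (fun w => ‖ψ (w, p.2)‖ ^ 2) 0 p.1 := by
      refine (hasDerivAt_const p.1 (1 : ℝ)).congr_of_eventuallyEq ?_
      filter_upwards [Ioo_mem_nhds hmem.1.1 hlt] with w hw
      rw [hn w ⟨hw.1.le, hw.2.le⟩ p.2 ⟨hmem.2.1.le, hmem.2.2⟩, one_pow]
    have h3 := h1.unique h2
    rw [hp, indicator_of_mem hmem, real_inner_smul_left]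
    have h4 : (inner ℝ (ψ p) (goursatU P F p) : ℝ) = 0 := by linarith
    rw [h4, mul_zero]
  · rw [hp, indicator_of_notMem hmem, inner_zero_left]

end

namespace IsWaveMapOn

variable {d : ℕ} {u₀ v₀ : ℝ} {φp φm : ℝ → Amb d} {ψ : ℝ × ℝ → Amb d}

theorem estimates (h : IsWaveMapOn u₀ v₀ φp φm ψ) (hp : LocallyAbsCont φp)
    (hm : LocallyAbsCont φm) (h0 : φp 0 = φm 0) :
    (∀ u u' v, 0 ≤ u → u ≤ u' → u' ≤ u₀ → v ∈ Icc 0 v₀ →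
      ‖ψ (u', v) - ψ (u, v)‖ ≤ ∫ x in u..u', ‖velocity φp x‖) ∧
    ∀ u u' v v', 0 ≤ u → u ≤ u' → u' ≤ u₀ → 0 ≤ v → v ≤ v' → v' ≤ v₀ →
      ‖mixedDiff ψ u u' v v'‖ ≤
        (∫ x in u..u', ‖velocity φp x‖) * ∫ x in v..v', ‖velocity φm x‖ := by
  obtain ⟨F, hFm, hF, hψ, hK⟩ := h.exists_goursat hp hm h0
  set P := velocity φp with hPdef
  set Q := velocity φm with hQdef
  have hPm : StronglyMeasurable P := stronglyMeasurable_velocity φp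
  have hQm : StronglyMeasurable Q := stronglyMeasurable_velocity φm
  have hP : LocallyIntegrable P := hp.locallyIntegrable_velocity
  have hQ : LocallyIntegrable Q := hm.locallyIntegrable_velocity
  have hF' := integrable_swap_volume hF
  have hFm' : StronglyMeasurable (F ∘ Prod.swap) := hFm.comp_measurable measurable_swap
  have hψ' : ∀ u ∈ Icc 0 v₀, ∀ v ∈ Icc 0 u₀,
      (ψ ∘ Prod.swap) (u, v) = goursat (φp 0) Q P (F ∘ Prod.swap) (u, v) := by
    intro u hu v hv
    rw [← goursat_swap hF]
    exact hψ v hv u hu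
  have hK' : F ∘ Prod.swap =ᵐ[volume] (Ioc 0 v₀ ×ˢ Ioc 0 u₀).indicator fun p =>
      (inner ℝ (partialU ψ p.swap) (partialV ψ p.swap) : ℝ) • (ψ ∘ Prod.swap) p := by
    filter_upwards [ae_swap hK] with p hp
    simp only [Function.comp]
    rw [hp]
    simp only [indicator, waveDensity, mem_prod, Prod.fst_swap, Prod.snd_swap]
    simp only [and_comm]
  have eu := ae_norm_goursatU_eq hP hQ hPm hF hFm hψ (fun u hu v hv => h.norm_eq hu hv) hK
  have ev := ae_norm_goursatU_eq hQ hP hQm hF' hFm' hψ' (fun u hu v hv => h.norm_eq hv hu) hK'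
  -- Conservation in both variables: inside the rectangle `|∂_u ψ|` and `|∂_v ψ|` equal the speeds
  -- of the data, and `|F| ≤ |∂_u ψ| |∂_v ψ|`.
  have hbound : ∀ᵐ p : ℝ × ℝ, ‖F p‖ ≤ ‖P p.1‖ * ‖Q p.2‖ := by
    filter_upwards [hK, ae_fst eu, ae_snd ev, ae_hasDerivAt_of_eq_goursat hP hQ hPm hF hFm hψ,
      ae_swap (ae_hasDerivAt_of_eq_goursat hQ hP hQm hF' hFm' hψ')] with p hp hu hv hdu hdv
    by_cases hmem : p ∈ Ioc 0 u₀ ×ˢ Ioc 0 v₀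
    · have h1 : partialU ψ p = goursatU P F p := (hdu hmem).2.deriv
      have h2 : partialV ψ p = goursatU Q (F ∘ Prod.swap) p.swap :=
        (hdv ⟨hmem.2, hmem.1⟩).2.deriv
      rw [hp, indicator_of_mem hmem, waveDensity, norm_smul,
        h.norm_eq (Ioc_subset_Icc_self hmem.1) (Ioc_subset_Icc_self hmem.2), mul_one,
        ← hu p.2, ← hv p.1]
      refine (norm_inner_le_norm _ _).trans_eq ?_
      rw [h1, h2]
      rfl
    · rw [hp, indicator_of_notMem hmem, norm_zero]
      positivity
  refine ⟨fun u u' v h1 h2 h3 hv => ?_, fun u u' v v' h1 h2 h3 h4 h5 h6 => ?_⟩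
  · rw [hψ u' ⟨h1.trans h2, h3⟩ v hv, hψ u ⟨h1, h2.trans h3⟩ v hv, goursat_sub hP hF]
    refine intervalIntegral.norm_integral_le_of_norm_le h2 ?_
      (hP.norm'.intervalIntegrable' _ _)
    filter_upwards [eu] with w hw _
    exact (hw v).le
  · have e : mixedDiff ψ u u' v v' =
        ∫ w in u..u', (goursatU P F (w, v') - goursatU P F (w, v)) := by
      have hi : ∀ v, IntervalIntegrable (fun w => goursatU P F (w, v)) volume u u' := fun v =>
        (hP.intervalIntegrable' _ _).sub
          ((integrable_integral_slice hF 0 v).locallyIntegrable.intervalIntegrable' _ _)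
      rw [intervalIntegral.integral_sub (hi _) (hi _), ← goursat_sub (c := φp 0) (Q := Q) hP hF,
        ← goursat_sub (c := φp 0) (Q := Q) hP hF, mixedDiff,
        hψ u' ⟨h1.trans h2, h3⟩ v' ⟨h4.trans h5, h6⟩, hψ u' ⟨h1.trans h2, h3⟩ v ⟨h4, h5.trans h6⟩,
        hψ u ⟨h1, h2.trans h3⟩ v' ⟨h4.trans h5, h6⟩, hψ u ⟨h1, h2.trans h3⟩ v ⟨h4, h5.trans h6⟩]
      abel
    rw [e, ← intervalIntegral.integral_mul_const]
    refine intervalIntegral.norm_integral_le_of_norm_le h2 ?_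
      ((hP.norm'.intervalIntegrable' _ _).mul_const _)
    have hbb : ∀ᵐ w : ℝ, ∀ᵐ z : ℝ, ‖F (w, z)‖ ≤ ‖P w‖ * ‖Q z‖ := by
      rw [Measure.volume_eq_prod] at hbound
      exact Measure.ae_ae_of_ae_prod hbound
    filter_upwards [hbb, ae_integrable_slice hF] with w hw hwi _
    have hli := hwi.locallyIntegrable
    have e2 : goursatU P F (w, v') - goursatU P F (w, v) = -∫ z in v..v', F (w, z) := by
      rw [← intervalIntegral.integral_interval_sub_left (hli.intervalIntegrable' 0 v')
        (hli.intervalIntegrable' 0 v)]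
      simp only [goursatU]
      abel
    rw [e2, norm_neg, ← intervalIntegral.integral_const_mul]
    refine intervalIntegral.norm_integral_le_of_norm_le h5 ?_
      ((hQ.norm'.intervalIntegrable' _ _).const_mul _)
    filter_upwards [hw] with z hz _
    exact hz

end IsWaveMapOn

/-! ### Extension from the quadrant to the plane -/

section

variable {d : ℕ}

/-- The extension of a field on the quadrant to the plane, constant along the normals. -/
def quadrantExtension (ψ : ℝ × ℝ → Amb d) (p : ℝ × ℝ) : Amb d := ψ (max p.1 0, max p.2 0)

theorem mk_mem_quadrant {u v : ℝ} (hu : 0 ≤ u) (hv : 0 ≤ v) : (u, v) ∈ quadrant := ⟨hu, hv⟩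

theorem eqOn_quadrantExtension (ψ : ℝ × ℝ → Amb d) : EqOn ψ (quadrantExtension ψ) quadrant := by
  rintro ⟨u, v⟩ ⟨hu, hv⟩
  simp only [quadrantExtension]
  rw [max_eq_left hu, max_eq_left hv]

/-- The velocity is zero on `(-∞, 0]`, so clamping the endpoints does not change the length. -/
theorem integral_norm_velocity_max {f : ℝ → Amb d} (hf : LocallyAbsCont f) (u u' : ℝ) :
    ∫ x in (max u 0)..(max u' 0), ‖velocity f x‖ = ∫ x in u..u', ‖velocity f x‖ := by
  have hi := hf.locallyIntegrable_velocity.norm'.intervalIntegrable'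
  have h0 : ∀ u : ℝ, ∫ x in u..(max u 0), ‖velocity f x‖ = 0 := by
    intro u
    rw [intervalIntegral.integral_of_le (le_max_left u 0)]
    refine setIntegral_eq_zero_of_forall_eq_zero fun x hx => ?_
    rcases le_total u 0 with h | h
    · rw [max_eq_right h] at hx
      rw [velocity, indicator_of_notMem (by simpa using hx.2), norm_zero]
    · rw [max_eq_left h] at hx
      exact absurd hx.2 (not_le.mpr hx.1)
  have h1 := intervalIntegral.integral_add_adjacent_intervals (hi u (max u 0)) (hi _ (max u' 0))
  have h2 := intervalIntegral.integral_add_adjacent_intervals (hi u u') (hi _ (max u' 0))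
  rw [h0, zero_add] at h1
  rw [h0, add_zero] at h2
  rw [h1, h2]

/-- Clamping turns estimates on the quadrant into estimates on the plane with the same bounds, so
that no edge needs separate treatment. -/
theorem isControlled_quadrantExtension {φp φm : ℝ → Amb d} {ψ : ℝ × ℝ → Amb d}
    (hp : LocallyAbsCont φp) (hm : LocallyAbsCont φm)
    (hn : ∀ u v, 0 ≤ u → 0 ≤ v → ‖ψ (u, v)‖ = 1)
    (hu : ∀ u u' v, 0 ≤ u → u ≤ u' → 0 ≤ v →
      ‖ψ (u', v) - ψ (u, v)‖ ≤ ∫ x in u..u', ‖velocity φp x‖)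
    (hv : ∀ u v v', 0 ≤ u → 0 ≤ v → v ≤ v' →
      ‖ψ (u, v') - ψ (u, v)‖ ≤ ∫ x in v..v', ‖velocity φm x‖)
    (huv : ∀ u u' v v', 0 ≤ u → u ≤ u' → 0 ≤ v → v ≤ v' → ‖mixedDiff ψ u u' v v'‖ ≤
      2 * ((∫ x in u..u', ‖velocity φp x‖) * ∫ x in v..v', ‖velocity φm x‖)) :
    IsControlled (fun x => ‖velocity φp x‖) (fun x => ‖velocity φm x‖) (quadrantExtension ψ) where
  measurable_a := (stronglyMeasurable_velocity φp).norm.measurable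
  measurable_b := (stronglyMeasurable_velocity φm).norm.measurable
  nonneg_a _ := norm_nonneg _
  nonneg_b _ := norm_nonneg _
  integrable_a := hp.locallyIntegrable_velocity.norm'
  integrable_b := hm.locallyIntegrable_velocity.norm'
  norm_eq _ := hn _ _ (le_max_right _ _) (le_max_right _ _)
  sub_u u u' v huu' := by
    rw [← integral_norm_velocity_max hp]
    exact hu _ _ _ (le_max_right _ _) (max_le_max_right 0 huu') (le_max_right _ _)
  sub_v u v v' hvv' := by
    rw [← integral_norm_velocity_max hm]
    exact hv _ _ _ (le_max_right _ _) (le_max_right _ _) (max_le_max_right 0 hvv')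
  mixed u u' v v' huu' hvv' := by
    rw [← integral_norm_velocity_max hp, ← integral_norm_velocity_max hm]
    exact huv _ _ _ _ (le_max_right _ _) (max_le_max_right 0 huu') (le_max_right _ _)
      (max_le_max_right 0 hvv')

theorem partialU_congr {ψ Ψ : ℝ × ℝ → Amb d} (h : EqOn ψ Ψ quadrant) {p : ℝ × ℝ}
    (h1 : 0 < p.1) (h2 : 0 ≤ p.2) : partialU ψ p = partialU Ψ p := by
  refine EventuallyEq.deriv_eq ?_
  filter_upwards [Ioi_mem_nhds h1] with w hw
  exact h (mk_mem_quadrant (le_of_lt hw) h2)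

theorem partialV_congr {ψ Ψ : ℝ × ℝ → Amb d} (h : EqOn ψ Ψ quadrant) {p : ℝ × ℝ}
    (h1 : 0 ≤ p.1) (h2 : 0 < p.2) : partialV ψ p = partialV Ψ p := by
  refine EventuallyEq.deriv_eq ?_
  filter_upwards [Ioi_mem_nhds h2] with z hz
  exact h (mk_mem_quadrant h1 (le_of_lt hz))

theorem integral_integral_waveDensity_congr {ψ Ψ : ℝ × ℝ → Amb d} (h : EqOn ψ Ψ quadrant)
    {u v : ℝ} (hu : 0 ≤ u) (hv : 0 ≤ v) :
    ∫ w in (0 : ℝ)..u, ∫ z in (0 : ℝ)..v, waveDensity ψ (w, z) =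
      ∫ w in (0 : ℝ)..u, ∫ z in (0 : ℝ)..v, waveDensity Ψ (w, z) := by
  refine intervalIntegral.integral_congr_ae (Eventually.of_forall fun w hw =>
    intervalIntegral.integral_congr_ae (Eventually.of_forall fun z hz => ?_))
  rw [uIoc_of_le hu] at hw
  rw [uIoc_of_le hv] at hz
  rw [waveDensity, waveDensity, partialU_congr h hw.1 hz.1.le, partialV_congr h hw.1.le hz.1,
    h (mk_mem_quadrant hw.1.le hz.1.le)]

end

/-- The primitive of the wave map density, as a function of the corner of the rectangle. -/
def densityPrimitive {d : ℕ} (φ : ℝ × ℝ → Amb d) (p : ℝ × ℝ) : Amb d :=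
  ∫ w in (0 : ℝ)..p.1, ∫ z in (0 : ℝ)..p.2, waveDensity φ (w, z)

theorem IsControlled.mixedDiff_densityPrimitive {d : ℕ} {a b : ℝ → ℝ} {φ : ℝ × ℝ → Amb d}
    (h : IsControlled a b φ) {u u' v v' : ℝ} (hu : 0 ≤ u) (huu' : u ≤ u') (hv : 0 ≤ v)
    (hvv' : v ≤ v') :
    mixedDiff (densityPrimitive φ) u u' v v' =
      ∫ w in u..u', ∫ z in v..v', waveDensity φ (w, z) := by
  have hms : MeasurableSet (Ioc 0 u' ×ˢ Ioc 0 v' : Set (ℝ × ℝ)) :=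
    measurableSet_Ioc.prod measurableSet_Ioc
  -- The density is integrable only on bounded sets; cutting it off outside the largest rectangle
  -- involved makes all slices integrable at once.
  set G : ℝ × ℝ → Amb d := (Ioc 0 u' ×ˢ Ioc 0 v').indicator (waveDensity φ) with hG
  have hGi : Integrable G :=
    (integrable_indicator_iff hms).mpr (h.integrableOn_waveDensity 0 u' 0 v')
  have hcongr : ∀ {p q r s : ℝ}, 0 ≤ p → p ≤ q → q ≤ u' → 0 ≤ r → r ≤ s → s ≤ v' →
      ∫ w in p..q, ∫ z in r..s, waveDensity φ (w, z) = ∫ w in p..q, ∫ z in r..s, G (w, z) := by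
    intro p q r s hp hpq hq hr hrs hs
    refine intervalIntegral.integral_congr_ae (Eventually.of_forall fun w hw =>
      intervalIntegral.integral_congr_ae (Eventually.of_forall fun z hz => ?_))
    rw [uIoc_of_le hpq] at hw
    rw [uIoc_of_le hrs] at hz
    exact (indicator_of_mem (show (w, z) ∈ Ioc 0 u' ×ˢ Ioc 0 v' from
      ⟨⟨hp.trans_lt hw.1, hw.2.trans hq⟩, ⟨hr.trans_lt hz.1, hz.2.trans hs⟩⟩) _).symm
  have hsl : ∀ r s p q : ℝ, IntervalIntegrable (fun w => ∫ z in r..s, G (w, z)) volume p q :=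
    fun r s p q => (integrable_integral_slice hGi r s).locallyIntegrable.intervalIntegrable' p q
  have hrow : ∀ p q : ℝ, (∫ w in p..q, ∫ z in v..v', G (w, z)) =
      (∫ w in p..q, ∫ z in (0 : ℝ)..v', G (w, z)) - ∫ w in p..q, ∫ z in (0 : ℝ)..v, G (w, z) := by
    intro p q
    rw [← intervalIntegral.integral_sub (hsl _ _ _ _) (hsl _ _ _ _)]
    refine intervalIntegral.integral_congr_ae ?_
    filter_upwards [ae_integrable_slice hGi] with w hw _
    exact (intervalIntegral.integral_interval_sub_left
      (hw.locallyIntegrable.intervalIntegrable' _ _)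
      (hw.locallyIntegrable.intervalIntegrable' _ _)).symm
  simp only [mixedDiff, densityPrimitive]
  rw [hcongr le_rfl (hu.trans huu') le_rfl le_rfl (hv.trans hvv') le_rfl,
    hcongr le_rfl (hu.trans huu') le_rfl le_rfl hv hvv',
    hcongr le_rfl hu huu' le_rfl (hv.trans hvv') le_rfl, hcongr le_rfl hu huu' le_rfl hv hvv',
    hcongr hu huu' le_rfl hv hvv' le_rfl, hrow,
    ← intervalIntegral.integral_interval_sub_left (hsl _ _ 0 u') (hsl _ _ 0 u),
    ← intervalIntegral.integral_interval_sub_left (hsl _ _ 0 u') (hsl _ _ 0 u)]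
  abel

/-! ### The scheme on dyadic grids -/

/-- Locally absolutely continuous sphere-valued boundary data which agree at the corner. -/
structure IsSphereData {d : ℕ} (φp φm : ℝ → Amb d) : Prop where
  mem_p : ∀ u : ℝ, 0 ≤ u → φp u ∈ unitSphere d
  mem_m : ∀ v : ℝ, 0 ≤ v → φm v ∈ unitSphere d
  ac_p : LocallyAbsCont φp
  ac_m : LocallyAbsCont φm
  corner : φp 0 = φm 0

/-- The length of a curve on `[0, u]`. -/
def arcLength {d : ℕ} (f : ℝ → Amb d) (u : ℝ) : ℝ := ∫ x in (0 : ℝ)..u, ‖velocity f x‖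

namespace LocallyAbsCont

variable {d : ℕ} {f : ℝ → Amb d}

theorem arcLength_sub (hf : LocallyAbsCont f) (u u' : ℝ) :
    arcLength f u' - arcLength f u = ∫ x in u..u', ‖velocity f x‖ :=
  intervalIntegral.integral_interval_sub_left
    (hf.locallyIntegrable_velocity.norm'.intervalIntegrable' _ _)
    (hf.locallyIntegrable_velocity.norm'.intervalIntegrable' _ _)

theorem continuous_arcLength (hf : LocallyAbsCont f) : Continuous (arcLength f) :=
  hf.locallyIntegrable_velocity.norm'.continuous_integral 0

theorem monotone_arcLength (hf : LocallyAbsCont f) : Monotone (arcLength f) := fun u u' h => by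
  rw [← sub_nonneg, hf.arcLength_sub]
  exact intervalIntegral.integral_nonneg h fun x _ => norm_nonneg _

theorem norm_sub_le_arcLength (hf : LocallyAbsCont f) {u u' : ℝ} (hu : 0 ≤ u) (huu' : u ≤ u') :
    ‖f u' - f u‖ ≤ arcLength f u' - arcLength f u :=
  (hf.norm_sub_le hu huu').trans_eq (hf.arcLength_sub _ _).symm

end LocallyAbsCont

/-- The arc length at the grid points of mesh size `2^{-N}`. -/
def gridLength {d : ℕ} (f : ℝ → Amb d) (N i : ℕ) : ℝ := arcLength f ((i : ℝ) / 2 ^ N)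

theorem monotone_div_two_pow (N : ℕ) : Monotone fun i : ℕ => (i : ℝ) / 2 ^ N := fun i j hij => by
  have : (i : ℝ) ≤ j := by exact_mod_cast hij
  change (i : ℝ) / 2 ^ N ≤ j / 2 ^ N
  gcongr

theorem cast_two_pow_mul_div (N k i : ℕ) :
    ((2 ^ k * i : ℕ) : ℝ) / 2 ^ (N + k) = (i : ℝ) / 2 ^ N := by
  push_cast
  rw [pow_add, mul_comm, mul_div_mul_right _ _ (by positivity)]

theorem gridLength_two_pow_mul {d : ℕ} (f : ℝ → Amb d) (N k i : ℕ) :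
    gridLength f (N + k) (2 ^ k * i) = gridLength f N i := by
  rw [gridLength, gridLength, cast_two_pow_mul_div]

theorem LocallyAbsCont.monotone_gridLength {d : ℕ} {f : ℝ → Amb d} (hf : LocallyAbsCont f)
    (N : ℕ) : Monotone (gridLength f N) := hf.monotone_arcLength.comp (monotone_div_two_pow N)

theorem LocallyAbsCont.eventually_gridLength_sub_le {d : ℕ} {f : ℝ → Amb d}
    (hf : LocallyAbsCont f) (K : ℕ) {ω : ℝ} (hω : 0 < ω) :
    ∀ᶠ N in atTop, ∀ i < K * 2 ^ N, gridLength f N (i + 1) - gridLength f N i ≤ ω := by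
  obtain ⟨δ, hδ, h⟩ := exists_modulus hf.continuous_arcLength K hω
  have ht : Tendsto (fun N : ℕ => ((2 : ℝ) ^ N)⁻¹) atTop (𝓝 0) :=
    (tendsto_pow_atTop_atTop_of_one_lt one_lt_two).inv_tendsto_atTop
  filter_upwards [ht.eventually (gt_mem_nhds hδ)] with N hN i hi
  have h2 : (0 : ℝ) < 2 ^ N := by positivity
  have hi1 : ((i + 1 : ℕ) : ℝ) / 2 ^ N ≤ K := by
    rw [div_le_iff₀ h2]
    exact_mod_cast hi
  refine (le_abs_self _).trans (h _ ⟨by positivity, hi1⟩ _ ⟨by positivity, ?_⟩ ?_).le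
  · exact (monotone_div_two_pow N (Nat.le_succ i)).trans hi1
  · have : ((i + 1 : ℕ) : ℝ) / 2 ^ N - i / 2 ^ N = (2 ^ N)⁻¹ := by
      push_cast
      field_simp
      ring
    rw [this, abs_of_pos (by positivity)]
    exact hN

theorem IsDiscreteWaveMap.norm_sub_le {d : ℕ} {Yp Ym : ℕ → Amb d} {Y : ℕ → ℕ → Amb d}
    (h : IsDiscreteWaveMap Yp Ym Y) {α β : ℕ → ℝ}
    (hu : ∀ i, ‖Yp (i + 1) - Yp i‖ ≤ α (i + 1) - α i)
    (hv : ∀ j, ‖Ym (j + 1) - Ym j‖ ≤ β (j + 1) - β j) {m m' n n' : ℕ} (hm : m ≤ m')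
    (hn : n ≤ n') : ‖Y m' n' - Y m n‖ ≤ (α m' - α m) + (β n' - β n) := by
  have h1 : ‖Y m' n' - Y m n'‖ ≤ α m' - α m := by
    rw [← Finset.sum_Ico_sub (fun i => Y i n') hm, ← Finset.sum_Ico_sub α hm]
    exact (norm_sum_le _ _).trans (Finset.sum_le_sum fun i _ =>
      (h.norm_sub_left i n').trans_le (hu i))
  have h2 : ‖Y m n' - Y m n‖ ≤ β n' - β n := by
    rw [← Finset.sum_Ico_sub (Y m) hn, ← Finset.sum_Ico_sub β hn]
    exact (norm_sum_le _ _).trans (Finset.sum_le_sum fun j _ =>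
      (h.norm_sub_right m j).trans_le (hv j))
  rw [← sub_add_sub_cancel _ (Y m n')]
  exact (norm_add_le _ _).trans (add_le_add h1 h2)

/-- The discrete wave map with mesh size `2^{-N}`. -/
def scheme {d : ℕ} (φp φm : ℝ → Amb d) (N : ℕ) : ℕ → ℕ → Amb d :=
  discreteWaveMap (fun n : ℕ => φp ((n : ℝ) / 2 ^ N)) (fun n : ℕ => φm ((n : ℝ) / 2 ^ N))

/-- The piecewise constant extension of the discrete wave map. -/
def schemeFloor {d : ℕ} (φp φm : ℝ → Amb d) (N : ℕ) (p : ℝ × ℝ) : Amb d :=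
  scheme φp φm N ⌊2 ^ N * p.1⌋₊ ⌊2 ^ N * p.2⌋₊

/-- The grid of mesh size `2^{-N}` divides the curve on `[0, K]` into pieces of length
at most `ω`. -/
def IsFineGrid {d : ℕ} (φp φm : ℝ → Amb d) (K : ℕ) (ω : ℝ) (N : ℕ) : Prop :=
  (∀ i < K * 2 ^ N, gridLength φp N (i + 1) - gridLength φp N i ≤ ω) ∧
    ∀ j < K * 2 ^ N, gridLength φm N (j + 1) - gridLength φm N j ≤ ω

/-- The stability constant of the scheme on the square `[0, K]²`. -/
def stabilityConst {d : ℕ} (φp φm : ℝ → Amb d) (K : ℕ) : ℝ :=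
  2 + 24 * Real.exp (5 * (arcLength φp K + arcLength φm K))

theorem stabilityConst_pos {d : ℕ} (φp φm : ℝ → Amb d) (K : ℕ) : 0 < stabilityConst φp φm K := by
  unfold stabilityConst
  positivity

theorem floor_lt_mul_two_pow {K N : ℕ} {u : ℝ} (hu : 0 ≤ u) (huK : u < K) :
    ⌊2 ^ N * u⌋₊ < K * 2 ^ N := by
  rw [Nat.floor_lt (by positivity)]
  push_cast
  rw [mul_comm (K : ℝ)]
  gcongr

theorem floor_div_le {N : ℕ} {u : ℝ} (hu : 0 ≤ u) : (⌊2 ^ N * u⌋₊ : ℝ) / 2 ^ N ≤ u := by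
  rw [div_le_iff₀ (by positivity), mul_comm u]
  exact Nat.floor_le (by positivity)

theorem le_floor_succ_div {N : ℕ} {u : ℝ} : u ≤ ((⌊2 ^ N * u⌋₊ + 1 : ℕ) : ℝ) / 2 ^ N := by
  rw [le_div_iff₀ (by positivity), mul_comm u]
  push_cast
  exact (Nat.lt_floor_add_one _).le

theorem tendsto_floor_div {u : ℝ} (hu : 0 ≤ u) :
    Tendsto (fun N : ℕ => (⌊2 ^ N * u⌋₊ : ℝ) / 2 ^ N) atTop (𝓝 u) := by
  have h := (tendsto_nat_floor_mul_div_atTop hu).comp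
    (tendsto_pow_atTop_atTop_of_one_lt (one_lt_two (α := ℝ)))
  refine h.congr fun N => ?_
  simp only [Function.comp, mul_comm u]

/-- The coarse grid corner of a point lies below and to the left of its fine grid corner, so
increments between them are controlled by monotonicity. -/
theorem two_pow_mul_floor_le {N k : ℕ} {u : ℝ} (hu : 0 ≤ u) :
    2 ^ k * ⌊2 ^ N * u⌋₊ ≤ ⌊2 ^ (N + k) * u⌋₊ := by
  rw [Nat.le_floor_iff (by positivity)]
  push_cast
  have := Nat.floor_le (show 0 ≤ 2 ^ N * u by positivity)
  calc (2 : ℝ) ^ k * ⌊2 ^ N * u⌋₊ ≤ 2 ^ k * (2 ^ N * u) := by gcongr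
    _ = 2 ^ (N + k) * u := by ring

namespace IsSphereData

variable {d : ℕ} {φp φm : ℝ → Amb d}

theorem isDiscreteWaveMap (h : IsSphereData φp φm) (N : ℕ) :
    IsDiscreteWaveMap (fun n : ℕ => φp ((n : ℝ) / 2 ^ N)) (fun n : ℕ => φm ((n : ℝ) / 2 ^ N))
      (scheme φp φm N) :=
  (isDiscreteWaveMap_iff (fun n => h.mem_p _ (by positivity)) (fun n => h.mem_m _ (by positivity))
    (by simp [h.corner]) _).mpr rfl

theorem norm_sub_p (h : IsSphereData φp φm) (N i : ℕ) :
    ‖φp (((i + 1 : ℕ) : ℝ) / 2 ^ N) - φp ((i : ℝ) / 2 ^ N)‖ ≤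
      gridLength φp N (i + 1) - gridLength φp N i :=
  h.ac_p.norm_sub_le_arcLength (by positivity) (monotone_div_two_pow N (Nat.le_succ i))

theorem norm_sub_m (h : IsSphereData φp φm) (N j : ℕ) :
    ‖φm (((j + 1 : ℕ) : ℝ) / 2 ^ N) - φm ((j : ℝ) / 2 ^ N)‖ ≤
      gridLength φm N (j + 1) - gridLength φm N j :=
  h.ac_m.norm_sub_le_arcLength (by positivity) (monotone_div_two_pow N (Nat.le_succ j))

theorem norm_scheme (h : IsSphereData φp φm) (N i j : ℕ) : ‖scheme φp φm N i j‖ = 1 :=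
  (h.isDiscreteWaveMap N).norm_eq_one i j

theorem norm_scheme_sub_le (h : IsSphereData φp φm) (N : ℕ) {m m' n n' : ℕ} (hm : m ≤ m')
    (hn : n ≤ n') : ‖scheme φp φm N m' n' - scheme φp φm N m n‖ ≤
      (gridLength φp N m' - gridLength φp N m) + (gridLength φm N n' - gridLength φm N n) :=
  (h.isDiscreteWaveMap N).norm_sub_le (h.norm_sub_p N) (h.norm_sub_m N) hm hn

/-- The bound `ω ≤ 1 / 2` ensures that the two edges of a cell have total length at most `1`, as the
one-cell estimates require. -/
theorem scheme_rectangle (h : IsSphereData φp φm) {K N : ℕ} {ω : ℝ} (hω : ω ≤ 1 / 2)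
    (hN : IsFineGrid φp φm K ω N) {m m' n n' : ℕ} (hm : m ≤ m') (hn : n ≤ n')
    (hmK : m' ≤ K * 2 ^ N) (hnK : n' ≤ K * 2 ^ N) :
    ‖scheme φp φm N m' n' - scheme φp φm N m' n - scheme φp φm N m n' + scheme φp φm N m n‖ ≤
      2 * ((gridLength φp N m' - gridLength φp N m) * (gridLength φm N n' - gridLength φm N n)) ∧
    ‖scheme φp φm N m' n' - scheme φp φm N m' n - scheme φp φm N m n' + scheme φp φm N m n +
      (inner ℝ (scheme φp φm N m' n - scheme φp φm N m n)
        (scheme φp φm N m n' - scheme φp φm N m n) : ℝ) • scheme φp φm N m n‖ ≤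
      12 * (gridLength φp N m' - gridLength φp N m + (gridLength φm N n' - gridLength φm N n)) *
      ((gridLength φp N m' - gridLength φp N m) * (gridLength φm N n' - gridLength φm N n)) :=
  (h.isDiscreteWaveMap N).norm_rectangle_le hm hn (h.ac_p.monotone_gridLength N)
    (h.ac_m.monotone_gridLength N) (h.norm_sub_p N) (h.norm_sub_m N) fun i j hi hj => by
      have h1 := hN.1 i (hi.trans_le hmK)
      have h2 := hN.2 j (hj.trans_le hnK)
      linarith

theorem eventually_isFineGrid (h : IsSphereData φp φm) (K : ℕ) {ω : ℝ} (hω : 0 < ω) :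
    ∀ᶠ N in atTop, IsFineGrid φp φm K ω N :=
  (h.ac_p.eventually_gridLength_sub_le K hω).and (h.ac_m.eventually_gridLength_sub_le K hω)

/-- A field on the grid which satisfies the scheme up to third order errors is close to the
solution of the scheme. -/
theorem norm_sub_scheme_le (h : IsSphereData φp φm) {K N : ℕ} {ω : ℝ} (hω0 : 0 ≤ ω)
    (hω : ω ≤ 1 / 2) (hN : IsFineGrid φp φm K ω N) {X : ℕ → ℕ → Amb d}
    (hXu : ∀ i j, ‖X (i + 1) j - X i j‖ ≤ gridLength φp N (i + 1) - gridLength φp N i)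
    (hXv : ∀ i j, ‖X i (j + 1) - X i j‖ ≤ gridLength φm N (j + 1) - gridLength φm N j)
    (hX2 : ∀ i j, i < K * 2 ^ N → j < K * 2 ^ N →
      ‖X (i + 1) (j + 1) - X (i + 1) j - X i (j + 1) + X i j +
        (inner ℝ (X (i + 1) j - X i j) (X i (j + 1) - X i j) : ℝ) • X i j‖ ≤
        12 * (gridLength φp N (i + 1) - gridLength φp N i +
          (gridLength φm N (j + 1) - gridLength φm N j)) *
        ((gridLength φp N (i + 1) - gridLength φp N i) *
          (gridLength φm N (j + 1) - gridLength φm N j)))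
    (hl : ∀ i, X i 0 = φp ((i : ℝ) / 2 ^ N)) (hr : ∀ j, X 0 j = φm ((j : ℝ) / 2 ^ N))
    {i j : ℕ} (hi : i ≤ K * 2 ^ N) (hj : j ≤ K * 2 ^ N) :
    ‖X i j - scheme φp φm N i j‖ ≤
      24 * ω * Real.exp (5 * (arcLength φp K + arcLength φm K)) := by
  have hY := h.isDiscreteWaveMap N
  have hα := h.ac_p.monotone_gridLength N
  have hβ := h.ac_m.monotone_gridLength N
  -- Each edge is at most `ω`, so the third order error `12 (a + b) a b` is at most `24 ω a b`: this
  -- is the `ε` of the Grönwall estimate.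
  have hgrid : ∀ i j, i < K * 2 ^ N → j < K * 2 ^ N →
      12 * (gridLength φp N (i + 1) - gridLength φp N i +
          (gridLength φm N (j + 1) - gridLength φm N j)) *
        ((gridLength φp N (i + 1) - gridLength φp N i) *
          (gridLength φm N (j + 1) - gridLength φm N j)) ≤
      24 * ω * ((gridLength φp N (i + 1) - gridLength φp N i) *
          (gridLength φm N (j + 1) - gridLength φm N j)) := by
    intro i j hi hj
    have h1 := hN.1 i hi
    have h2 := hN.2 j hj
    have h3 : 0 ≤ gridLength φp N (i + 1) - gridLength φp N i := sub_nonneg.mpr (hα (Nat.le_succ i))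
    have h4 : 0 ≤ gridLength φm N (j + 1) - gridLength φm N j := sub_nonneg.mpr (hβ (Nat.le_succ j))
    refine mul_le_mul_of_nonneg_right ?_ (mul_nonneg h3 h4)
    linarith
  have key := norm_sub_le_of_approx (X := X) (Y := scheme φp φm N) (M := K * 2 ^ N)
    (N := K * 2 ^ N) (ε := 24 * ω) (by positivity) hα hβ (fun i j _ _ => h.norm_scheme N i j)
    (fun i j _ _ => hXu i j) (fun i j _ _ => hXv i j)
    (fun i j _ _ => (hY.norm_sub_left i j).trans_le (h.norm_sub_p N i))
    (fun i j _ _ => (hY.norm_sub_right i j).trans_le (h.norm_sub_m N j))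
    (fun i j hi hj => (hX2 i j hi hj).trans (hgrid i j hi hj))
    (fun i j hi hj => (h.scheme_rectangle hω hN (Nat.le_succ i) (Nat.le_succ j) hi hj).2.trans
      (hgrid i j hi hj))
    (fun i _ => (hl i).trans (hY.left i).symm) (fun j _ => (hr j).trans (hY.right j).symm) hi hj
  refine key.trans ?_
  have hend : ∀ {f : ℝ → Amb d}, LocallyAbsCont f → ∀ i ≤ K * 2 ^ N,
      gridLength f N i - gridLength f N 0 ≤ arcLength f K := by
    intro f hf i hi
    have h1 : gridLength f N 0 = 0 := by simp [gridLength, arcLength]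
    rw [h1, sub_zero]
    refine hf.monotone_arcLength ?_
    rw [div_le_iff₀ (by positivity)]
    exact_mod_cast hi
  have h1 := hend h.ac_p i hi
  have h2 := hend h.ac_m j hj
  gcongr

theorem gridLength_floor_sub_le {f : ℝ → Amb d} (hf : LocallyAbsCont f) {K N : ℕ} {ω : ℝ}
    (hN : ∀ i < K * 2 ^ N, gridLength f N (i + 1) - gridLength f N i ≤ ω) {u x : ℝ} (hu : 0 ≤ u)
    (huK : u < K) (hx : x ≤ u) :
    arcLength f x - gridLength f N ⌊2 ^ N * u⌋₊ ≤ ω := by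
  refine le_trans ?_ (hN _ (floor_lt_mul_two_pow hu huK))
  exact sub_le_sub_right (hf.monotone_arcLength (hx.trans le_floor_succ_div)) _

/-- The fine solution restricted to the coarse grid has the same boundary values as the coarse one
and, by the rectangle estimate on the fine grid, solves the coarse scheme up to third order errors.
The bound does not depend on `k`. -/
theorem norm_schemeFloor_sub_le (h : IsSphereData φp φm) {K N k : ℕ} {ω : ℝ} (hω0 : 0 ≤ ω)
    (hω : ω ≤ 1 / 2) (hN : IsFineGrid φp φm K ω N) (hNk : IsFineGrid φp φm K ω (N + k))
    {u v : ℝ} (hu : 0 ≤ u) (hv : 0 ≤ v) (huK : u < K) (hvK : v < K) :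
    ‖schemeFloor φp φm (N + k) (u, v) - schemeFloor φp φm N (u, v)‖ ≤
      ω * stabilityConst φp φm K := by
  set X : ℕ → ℕ → Amb d := fun i j => scheme φp φm (N + k) (2 ^ k * i) (2 ^ k * j) with hX
  have hmul : ∀ i, 2 ^ k * i ≤ 2 ^ k * (i + 1) := fun i => Nat.mul_le_mul_left _ (Nat.le_succ i)
  have hmulK : ∀ i, i < K * 2 ^ N → 2 ^ k * (i + 1) ≤ K * 2 ^ (N + k) := by
    intro i hi
    calc 2 ^ k * (i + 1) ≤ 2 ^ k * (K * 2 ^ N) := Nat.mul_le_mul_left _ hi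
      _ = K * 2 ^ (N + k) := by ring
  have h1 := h.norm_sub_scheme_le (X := X) hω0 hω hN
    (fun i j => by
      have := h.norm_scheme_sub_le (N + k) (hmul i) (le_refl (2 ^ k * j))
      simpa only [gridLength_two_pow_mul, sub_self, add_zero] using this)
    (fun i j => by
      have := h.norm_scheme_sub_le (N + k) (le_refl (2 ^ k * i)) (hmul j)
      simpa only [gridLength_two_pow_mul, sub_self, zero_add] using this)
    (fun i j hi hj => by
      have := (h.scheme_rectangle hω hNk (hmul i) (hmul j) (hmulK i hi) (hmulK j hj)).2
      simpa only [gridLength_two_pow_mul] using this)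
    (fun i => by
      rw [hX, ← cast_two_pow_mul_div N k i]
      exact (h.isDiscreteWaveMap (N + k)).left _)
    (fun j => by
      rw [hX, ← cast_two_pow_mul_div N k j]
      exact (h.isDiscreteWaveMap (N + k)).right _)
    (floor_lt_mul_two_pow hu huK).le (floor_lt_mul_two_pow hv hvK).le
  have h2 := h.norm_scheme_sub_le (N + k) (two_pow_mul_floor_le (N := N) (k := k) hu)
    (two_pow_mul_floor_le (N := N) (k := k) hv)
  have h3 := gridLength_floor_sub_le h.ac_p hN.1 hu huK (floor_div_le (N := N + k) hu)
  have h4 := gridLength_floor_sub_le h.ac_m hN.2 hv hvK (floor_div_le (N := N + k) hv)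
  rw [gridLength_two_pow_mul, gridLength_two_pow_mul] at h2
  change arcLength φp _ - _ + (arcLength φm _ - _) ≥ _ at h2
  have e : schemeFloor φp φm (N + k) (u, v) - schemeFloor φp φm N (u, v) =
      (schemeFloor φp φm (N + k) (u, v) - X ⌊2 ^ N * u⌋₊ ⌊2 ^ N * v⌋₊) +
        (X ⌊2 ^ N * u⌋₊ ⌊2 ^ N * v⌋₊ - scheme φp φm N ⌊2 ^ N * u⌋₊ ⌊2 ^ N * v⌋₊) := by
    simp only [schemeFloor]
    abel
  rw [e]
  -- Passing between the coarse and fine corners costs `ω` in each variable, and stability costs `24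
  -- ω` times the exponential: together `ω * stabilityConst`.
  refine (norm_add_le _ _).trans ((add_le_add h2 h1).trans ?_)
  rw [stabilityConst]
  linarith

/-- The interpolant is a convex combination of the four corner values, each within `2ω` of the lower
left one. -/
theorem norm_schemeSolution_sub_le (h : IsSphereData φp φm) {K N : ℕ} {ω : ℝ}
    (hN : IsFineGrid φp φm K ω N) {u v : ℝ} (hu : 0 ≤ u) (hv : 0 ≤ v) (huK : u < K)
    (hvK : v < K) :
    ‖schemeSolution N φp φm (u, v) - schemeFloor φp φm N (u, v)‖ ≤ 2 * ω := by
  have hm := hN.1 _ (floor_lt_mul_two_pow (N := N) hu huK)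
  have hn := hN.2 _ (floor_lt_mul_two_pow (N := N) hv hvK)
  have hω : 0 ≤ ω := (sub_nonneg.mpr (h.ac_p.monotone_gridLength N (Nat.le_succ _))).trans hm
  simp only [schemeSolution, gridExtension, schemeFloor]
  set m := ⌊2 ^ N * u⌋₊
  set n := ⌊2 ^ N * v⌋₊
  set s := Int.fract (2 ^ N * u)
  set t := Int.fract (2 ^ N * v)
  have hs0 : 0 ≤ s := Int.fract_nonneg _
  have hs1 : 0 ≤ 1 - s := sub_nonneg.mpr (Int.fract_lt_one _).le
  have ht0 : 0 ≤ t := Int.fract_nonneg _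
  have ht1 : 0 ≤ 1 - t := sub_nonneg.mpr (Int.fract_lt_one _).le
  change ‖((1 - s) * (1 - t)) • scheme φp φm N m n + (s * (1 - t)) • scheme φp φm N (m + 1) n +
    ((1 - s) * t) • scheme φp φm N m (n + 1) + (s * t) • scheme φp φm N (m + 1) (n + 1) -
      scheme φp φm N m n‖ ≤ 2 * ω
  have h1 := h.norm_scheme_sub_le N (Nat.le_succ m) (le_refl n)
  have h2 := h.norm_scheme_sub_le N (le_refl m) (Nat.le_succ n)
  have h3 := h.norm_scheme_sub_le N (Nat.le_succ m) (Nat.le_succ n)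
  rw [sub_self, add_zero] at h1
  rw [sub_self, zero_add] at h2
  have e : ((1 - s) * (1 - t)) • scheme φp φm N m n + (s * (1 - t)) • scheme φp φm N (m + 1) n +
      ((1 - s) * t) • scheme φp φm N m (n + 1) + (s * t) • scheme φp φm N (m + 1) (n + 1) -
      scheme φp φm N m n =
      (s * (1 - t)) • (scheme φp φm N (m + 1) n - scheme φp φm N m n) +
      ((1 - s) * t) • (scheme φp φm N m (n + 1) - scheme φp φm N m n) +
      (s * t) • (scheme φp φm N (m + 1) (n + 1) - scheme φp φm N m n) := by
    module
  rw [e]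
  refine norm_add₃_le.trans ?_
  rw [norm_smul, norm_smul, norm_smul, Real.norm_of_nonneg (by positivity),
    Real.norm_of_nonneg (by positivity), Real.norm_of_nonneg (by positivity)]
  calc _ ≤ s * (1 - t) * (2 * ω) + (1 - s) * t * (2 * ω) + s * t * (2 * ω) := by
        gcongr
        · linarith
        · linarith
        · linarith
    _ = (1 - (1 - s) * (1 - t)) * (2 * ω) := by ring
    _ ≤ 1 * (2 * ω) := by
        have : 0 ≤ (1 - s) * (1 - t) := by positivity
        gcongr
        linarith
    _ = 2 * ω := one_mul _

end IsSphereData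

/-! ### The limit of the scheme is a wave map -/

/-- The pointwise limit of the discrete wave maps. -/
def schemeLimit {d : ℕ} (φp φm : ℝ → Amb d) (p : ℝ × ℝ) : Amb d :=
  limUnder atTop fun N => schemeFloor φp φm N p

namespace IsSphereData

variable {d : ℕ} {φp φm : ℝ → Amb d}

theorem exists_pos_le_half {C ε : ℝ} (hC : 0 < C) (hε : 0 < ε) :
    ∃ ω : ℝ, 0 < ω ∧ ω ≤ 1 / 2 ∧ ω * C ≤ ε := by
  refine ⟨min (1 / 2) (ε / C), lt_min (by norm_num) (div_pos hε hC), min_le_left _ _, ?_⟩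
  exact (mul_le_mul_of_nonneg_right (min_le_right _ _) hC.le).trans_eq (div_mul_cancel₀ _ hC.ne')

theorem exists_forall_norm_schemeFloor_sub_le (h : IsSphereData φp φm) (K : ℕ) {ε : ℝ}
    (hε : 0 < ε) : ∃ N₀, ∀ N ≥ N₀, ∀ (k : ℕ) (u v : ℝ), 0 ≤ u → 0 ≤ v → u < K → v < K →
      ‖schemeFloor φp φm (N + k) (u, v) - schemeFloor φp φm N (u, v)‖ ≤ ε := by
  obtain ⟨ω, hω0, hω, hωε⟩ := exists_pos_le_half (stabilityConst_pos φp φm K) hε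
  obtain ⟨N₀, hN₀⟩ := eventually_atTop.mp (h.eventually_isFineGrid K hω0)
  refine ⟨N₀, fun N hN k u v hu hv huK hvK => ?_⟩
  exact (h.norm_schemeFloor_sub_le hω0.le hω (hN₀ N hN) (hN₀ _ (le_add_right hN)) hu hv huK
    hvK).trans hωε

theorem tendsto_schemeFloor (h : IsSphereData φp φm) {u v : ℝ} (hu : 0 ≤ u) (hv : 0 ≤ v) :
    Tendsto (fun N => schemeFloor φp φm N (u, v)) atTop (𝓝 (schemeLimit φp φm (u, v))) := by
  refine CauchySeq.tendsto_limUnder ?_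
  rw [Metric.cauchySeq_iff']
  intro ε hε
  obtain ⟨K, hK⟩ := exists_nat_gt (max u v)
  obtain ⟨N₀, hN₀⟩ := h.exists_forall_norm_schemeFloor_sub_le K (half_pos hε)
  refine ⟨N₀, fun N hN => ?_⟩
  obtain ⟨k, rfl⟩ := Nat.exists_eq_add_of_le hN
  rw [dist_eq_norm]
  exact (hN₀ N₀ le_rfl k u v hu hv ((le_max_left _ _).trans_lt hK)
    ((le_max_right _ _).trans_lt hK)).trans_lt (half_lt_self hε)

theorem tendsto_gridLength_floor {f : ℝ → Amb d} (hf : LocallyAbsCont f) {u : ℝ} (hu : 0 ≤ u) :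
    Tendsto (fun N => gridLength f N ⌊2 ^ N * u⌋₊) atTop (𝓝 (arcLength f u)) :=
  (hf.continuous_arcLength.tendsto u).comp (tendsto_floor_div hu)

theorem norm_schemeLimit (h : IsSphereData φp φm) {u v : ℝ} (hu : 0 ≤ u) (hv : 0 ≤ v) :
    ‖schemeLimit φp φm (u, v)‖ = 1 := by
  refine tendsto_nhds_unique (h.tendsto_schemeFloor hu hv).norm ?_
  simp only [schemeFloor, h.norm_scheme]
  exact tendsto_const_nhds

theorem floor_le_floor' {N : ℕ} {u u' : ℝ} (h : u ≤ u') : ⌊2 ^ N * u⌋₊ ≤ ⌊2 ^ N * u'⌋₊ :=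
  Nat.floor_le_floor (mul_le_mul_of_nonneg_left h (by positivity))

theorem norm_schemeLimit_sub_le (h : IsSphereData φp φm) {u u' v v' : ℝ} (hu : 0 ≤ u)
    (huu' : u ≤ u') (hv : 0 ≤ v) (hvv' : v ≤ v') :
    ‖schemeLimit φp φm (u', v') - schemeLimit φp φm (u, v)‖ ≤
      (arcLength φp u' - arcLength φp u) + (arcLength φm v' - arcLength φm v) := by
  refine le_of_tendsto_of_tendsto' ((h.tendsto_schemeFloor (hu.trans huu')
    (hv.trans hvv')).sub (h.tendsto_schemeFloor hu hv)).norm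
    (((tendsto_gridLength_floor h.ac_p (hu.trans huu')).sub
      (tendsto_gridLength_floor h.ac_p hu)).add
    ((tendsto_gridLength_floor h.ac_m (hv.trans hvv')).sub
      (tendsto_gridLength_floor h.ac_m hv))) fun N => ?_
  exact h.norm_scheme_sub_le N (floor_le_floor' huu') (floor_le_floor' hvv')

/-- The constants `2` and `12` do not depend on the mesh, so the estimates on grid rectangles pass
to the limit as the grid corners converge to the given ones. -/
theorem schemeLimit_rectangle (h : IsSphereData φp φm) {u u' v v' : ℝ} (hu : 0 ≤ u)
    (huu' : u ≤ u') (hv : 0 ≤ v) (hvv' : v ≤ v') :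
    ‖mixedDiff (schemeLimit φp φm) u u' v v'‖ ≤
      2 * ((arcLength φp u' - arcLength φp u) * (arcLength φm v' - arcLength φm v)) ∧
    ‖mixedDiff (schemeLimit φp φm) u u' v v' +
      (inner ℝ (schemeLimit φp φm (u', v) - schemeLimit φp φm (u, v))
        (schemeLimit φp φm (u, v') - schemeLimit φp φm (u, v)) : ℝ) • schemeLimit φp φm (u, v)‖ ≤
      12 * (arcLength φp u' - arcLength φp u + (arcLength φm v' - arcLength φm v)) *
      ((arcLength φp u' - arcLength φp u) * (arcLength φm v' - arcLength φm v)) := by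
  obtain ⟨K, hK⟩ := exists_nat_gt (max u' v')
  have hfine := h.eventually_isFineGrid K (ω := 1 / 2) (by norm_num)
  have hu' := hu.trans huu'
  have hv' := hv.trans hvv'
  have huK := (le_max_left u' v').trans_lt hK
  have hvK := (le_max_right u' v').trans_lt hK
  have t00 := h.tendsto_schemeFloor hu hv
  have t10 := h.tendsto_schemeFloor hu' hv
  have t01 := h.tendsto_schemeFloor hu hv'
  have t11 := h.tendsto_schemeFloor hu' hv'
  have tA := (tendsto_gridLength_floor h.ac_p hu').sub (tendsto_gridLength_floor h.ac_p hu)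
  have tB := (tendsto_gridLength_floor h.ac_m hv').sub (tendsto_gridLength_floor h.ac_m hv)
  have tbox := ((t11.sub t10).sub t01).add t00
  have key : ∀ᶠ N in atTop, _ := hfine.mono fun N hN =>
    h.scheme_rectangle le_rfl hN (floor_le_floor' (N := N) huu') (floor_le_floor' (N := N) hvv')
      (floor_lt_mul_two_pow hu' huK).le (floor_lt_mul_two_pow hv' hvK).le
  constructor
  · exact le_of_tendsto_of_tendsto tbox.norm ((tA.mul tB).const_mul 2)
      (key.mono fun N hN => hN.1)
  · exact le_of_tendsto_of_tendsto
      (tbox.add (((t10.sub t00).inner (t01.sub t00)).smul t00)).norm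
      (((tA.add tB).const_mul 12).mul (tA.mul tB)) (key.mono fun N hN => hN.2)

theorem tendsto_comp_floor_div {f : ℝ → Amb d} (hf : LocallyAbsCont f) {u : ℝ} (hu : 0 ≤ u) :
    Tendsto (fun N : ℕ => f ((⌊2 ^ N * u⌋₊ : ℝ) / 2 ^ N)) atTop (𝓝 (f u)) := by
  have hc : ContinuousWithinAt f (Ici 0) u := by
    have h1 := (hf (u + 1) (by linarith)).continuousOn u (by
      rw [uIcc_of_le (by linarith)]; exact ⟨hu, by linarith⟩)
    rw [uIcc_of_le (by linarith)] at h1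
    refine h1.mono_of_mem_nhdsWithin ?_
    rw [← Ici_inter_Iic]
    exact inter_mem self_mem_nhdsWithin (mem_nhdsWithin_of_mem_nhds (Iic_mem_nhds (by linarith)))
  have ht : Tendsto (fun N : ℕ => (⌊2 ^ N * u⌋₊ : ℝ) / 2 ^ N) atTop (𝓝[Ici 0] u) :=
    tendsto_nhdsWithin_iff.mpr ⟨tendsto_floor_div hu, Eventually.of_forall fun N => by
      change (0 : ℝ) ≤ _; positivity⟩
  exact Tendsto.comp hc ht

theorem schemeLimit_left (h : IsSphereData φp φm) {u : ℝ} (hu : 0 ≤ u) :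
    schemeLimit φp φm (u, 0) = φp u := by
  refine tendsto_nhds_unique (h.tendsto_schemeFloor hu le_rfl)
    ((tendsto_comp_floor_div h.ac_p hu).congr fun N => ?_)
  simp only [schemeFloor, mul_zero, Nat.floor_zero]
  exact ((h.isDiscreteWaveMap N).left _).symm

theorem schemeLimit_right (h : IsSphereData φp φm) {v : ℝ} (hv : 0 ≤ v) :
    schemeLimit φp φm (0, v) = φm v := by
  refine tendsto_nhds_unique (h.tendsto_schemeFloor le_rfl hv)
    ((tendsto_comp_floor_div h.ac_m hv).congr fun N => ?_)
  simp only [schemeFloor, mul_zero, Nat.floor_zero]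
  exact ((h.isDiscreteWaveMap N).right _).symm

theorem isControlled_limit (h : IsSphereData φp φm) :
    IsControlled (fun x => ‖velocity φp x‖) (fun x => ‖velocity φm x‖)
      (quadrantExtension (schemeLimit φp φm)) := by
  refine isControlled_quadrantExtension h.ac_p h.ac_m (fun u v hu hv => h.norm_schemeLimit hu hv)
    (fun u u' v hu huu' hv => ?_) (fun u v v' hu hv hvv' => ?_)
    (fun u u' v v' hu huu' hv hvv' => ?_)
  · have := h.norm_schemeLimit_sub_le hu huu' hv le_rfl
    rwa [sub_self, add_zero, h.ac_p.arcLength_sub] at this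
  · have := h.norm_schemeLimit_sub_le hu le_rfl hv hvv'
    rwa [sub_self, zero_add, h.ac_m.arcLength_sub] at this
  · have := (h.schemeLimit_rectangle hu huu' hv hvv').1
    rwa [h.ac_p.arcLength_sub, h.ac_m.arcLength_sub] at this

theorem mixedDiff_congr {ψ Ψ : ℝ × ℝ → Amb d} (h : EqOn ψ Ψ quadrant) {u u' v v' : ℝ} (hu : 0 ≤ u)
    (huu' : u ≤ u') (hv : 0 ≤ v) (hvv' : v ≤ v') :
    mixedDiff ψ u u' v v' = mixedDiff Ψ u u' v v' := by
  have hu' := hu.trans huu'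
  have hv' := hv.trans hvv'
  rw [mixedDiff, h (mk_mem_quadrant hu' hv'), h (mk_mem_quadrant hu' hv),
    h (mk_mem_quadrant hu hv'), h (mk_mem_quadrant hu hv), mixedDiff]

/-- The limit of the scheme is a wave map. -/
theorem isWaveMap_limit (h : IsSphereData φp φm) :
    IsWaveMap φp φm (quadrantExtension (schemeLimit φp φm)) := by
  have hΨ := h.isControlled_limit
  have heq := eqOn_quadrantExtension (schemeLimit φp φm)
  set Ψ := quadrantExtension (schemeLimit φp φm) with hΨdef
  have hzero : ∀ {u v : ℝ}, 0 ≤ u → 0 ≤ v →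
      mixedDiff (fun p => Ψ p + densityPrimitive Ψ p) 0 u 0 v = 0 := by
    intro u v hu hv
    -- The constant is `12 + 3`, from the rectangle estimate of the limit and the comparison of its
    -- density integral with the product of increments.
    refine mixedDiff_eq_zero (C := 15) (by norm_num) h.ac_p.continuous_arcLength
      h.ac_m.continuous_arcLength h.ac_p.monotone_arcLength h.ac_m.monotone_arcLength ?_ hu hv
    intro u u' v v' hu huu' hv hvv'
    have h1 := (h.schemeLimit_rectangle hu huu' hv hvv').2
    rw [mixedDiff_congr heq hu huu' hv hvv', heq (mk_mem_quadrant (hu.trans huu') hv),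
      heq (mk_mem_quadrant hu (hv.trans hvv')), heq (mk_mem_quadrant hu hv)] at h1
    have h2 := hΨ.norm_integral_waveDensity_sub_le huu' hvv'
    rw [← hΨ.mixedDiff_densityPrimitive hu huu' hv hvv', ← h.ac_p.arcLength_sub,
      ← h.ac_m.arcLength_sub] at h2
    have e : mixedDiff (fun p => Ψ p + densityPrimitive Ψ p) u u' v v' =
        (mixedDiff Ψ u u' v v' +
          (inner ℝ (Ψ (u', v) - Ψ (u, v)) (Ψ (u, v') - Ψ (u, v)) : ℝ) • Ψ (u, v)) +
        (mixedDiff (densityPrimitive Ψ) u u' v v' -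
          (inner ℝ (Ψ (u', v) - Ψ (u, v)) (Ψ (u, v') - Ψ (u, v)) : ℝ) • Ψ (u, v)) := by
      simp only [mixedDiff]
      abel
    rw [e]
    refine (norm_add_le _ _).trans ((add_le_add h1 h2).trans_eq ?_)
    ring
  intro u₀ v₀ hu₀ hv₀
  refine ⟨fun p _ => mem_sphere_zero_iff_norm.mpr (hΨ.norm_eq p),
    hΨ.continuous.aestronglyMeasurable,
    ae_restrict_of_ae (hΨ.ae_partialU.mono fun p hp => hp.1),
    ae_restrict_of_ae (hΨ.ae_partialV.mono fun p hp => hp.1),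
    (hΨ.integrableOn_inner (-1) u₀ (-1) v₀).mono_set (prod_mono ?_ ?_), ?_⟩
  · exact fun x hx => ⟨by linarith [hx.1], hx.2⟩
  · exact fun x hx => ⟨by linarith [hx.1], hx.2⟩
  · intro u hu v hv
    have h1 := hzero hu.1 hv.1
    have hJ : densityPrimitive Ψ (u, 0) = 0 := by simp [densityPrimitive]
    have hJ' : ∀ v, densityPrimitive Ψ (0, v) = 0 := fun v => by simp [densityPrimitive]
    simp only [mixedDiff, hJ, hJ', add_zero] at h1
    rw [← heq (mk_mem_quadrant hu.1 le_rfl), ← heq (mk_mem_quadrant le_rfl hv.1),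
      ← heq (mk_mem_quadrant le_rfl le_rfl), h.schemeLimit_left hu.1, h.schemeLimit_right hv.1,
      h.schemeLimit_left le_rfl] at h1
    change Ψ (u, v) = φp u + φm v - φp 0 - densityPrimitive Ψ (u, v)
    rw [← sub_eq_zero, ← h1]
    abel

/-! ### Convergence of the scheme to every wave map -/

/-- Conservation of energy gives an arbitrary wave map the same bounds as the limit of the scheme.
Rectangles are enlarged by `1` to have positive sides. -/
theorem isControlled_of_isWaveMap (h : IsSphereData φp φm) {ψ : ℝ × ℝ → Amb d}
    (hψ : IsWaveMap φp φm ψ) :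
    IsControlled (fun x => ‖velocity φp x‖) (fun x => ‖velocity φm x‖)
      (quadrantExtension ψ) := by
  refine isControlled_quadrantExtension h.ac_p h.ac_m (fun u v hu hv => ?_)
    (fun u u' v hu huu' hv => ?_) (fun u v v' hu hv hvv' => ?_)
    (fun u u' v v' hu huu' hv hvv' => ?_)
  · exact (hψ (u + 1) (v + 1) (by linarith) (by linarith)).norm_eq ⟨hu, by linarith⟩
      ⟨hv, by linarith⟩
  · exact ((hψ (u' + 1) (v + 1) (by linarith) (by linarith)).estimates h.ac_p h.ac_m
      h.corner).1 u u' v hu huu' (by linarith) ⟨hv, by linarith⟩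
  · exact (((hψ (u + 1) (v' + 1) (by linarith) (by linarith)).swap h.corner).estimates h.ac_m
      h.ac_p h.corner.symm).1 v v' u hv hvv' (by linarith) ⟨hu, by linarith⟩
  · have h1 := ((hψ (u' + 1) (v' + 1) (by linarith) (by linarith)).estimates h.ac_p h.ac_m
      h.corner).2 u u' v v' hu huu' (by linarith) hv hvv' (by linarith)
    -- A wave map satisfies the mixed bound with constant `1`; since the product of lengths is
    -- nonnegative, constant `2` follows.
    have h2 := (norm_nonneg _).trans h1
    linarith

/-- By the integrated equation the mixed difference is minus the integral of the density, so the
comparison for controlled fields applies directly. -/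
theorem waveMap_rectangle (h : IsSphereData φp φm) {ψ : ℝ × ℝ → Amb d}
    (hψ : IsWaveMap φp φm ψ) {u u' v v' : ℝ} (hu : 0 ≤ u) (huu' : u ≤ u') (hv : 0 ≤ v)
    (hvv' : v ≤ v') :
    ‖mixedDiff ψ u u' v v' +
      (inner ℝ (ψ (u', v) - ψ (u, v)) (ψ (u, v') - ψ (u, v)) : ℝ) • ψ (u, v)‖ ≤
      3 * (arcLength φp u' - arcLength φp u + (arcLength φm v' - arcLength φm v)) *
      ((arcLength φp u' - arcLength φp u) * (arcLength φm v' - arcLength φm v)) := by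
  have hΨ := h.isControlled_of_isWaveMap hψ
  have heq := eqOn_quadrantExtension ψ
  set Ψ := quadrantExtension ψ with hΨdef
  have hu' := hu.trans huu'
  have hv' := hv.trans hvv'
  have heqn : ∀ {u v : ℝ}, 0 ≤ u → 0 ≤ v →
      ψ (u, v) = φp u + φm v - φp 0 - densityPrimitive Ψ (u, v) := by
    intro u v hu hv
    have h1 := (hψ (u + 1) (v + 1) (by linarith) (by linarith)).integral_eq u ⟨hu, by linarith⟩ v
      ⟨hv, by linarith⟩
    rw [h1]
    congr 1
    exact integral_integral_waveDensity_congr heq hu hv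
  have h2 := hΨ.norm_integral_waveDensity_sub_le huu' hvv'
  rw [← hΨ.mixedDiff_densityPrimitive hu huu' hv hvv', ← h.ac_p.arcLength_sub,
    ← h.ac_m.arcLength_sub, ← heq (mk_mem_quadrant hu' hv), ← heq (mk_mem_quadrant hu hv'),
    ← heq (mk_mem_quadrant hu hv)] at h2
  have e : mixedDiff ψ u u' v v' = -mixedDiff (densityPrimitive Ψ) u u' v v' := by
    simp only [mixedDiff]
    rw [heqn hu' hv', heqn hu' hv, heqn hu hv', heqn hu hv]
    abel
  rw [e, neg_add_eq_sub, norm_sub_rev]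
  exact h2

/-- The scheme converges to every wave map. -/
theorem tendsto_schemeFloor_of_isWaveMap (h : IsSphereData φp φm) {ψ : ℝ × ℝ → Amb d}
    (hψ : IsWaveMap φp φm ψ) {u v : ℝ} (hu : 0 ≤ u) (hv : 0 ≤ v) :
    Tendsto (fun N => schemeFloor φp φm N (u, v)) atTop (𝓝 (ψ (u, v))) := by
  obtain ⟨K, hK⟩ := exists_nat_gt (max u v)
  have huK := (le_max_left u v).trans_lt hK
  have hvK := (le_max_right u v).trans_lt hK
  have hΨ := h.isControlled_of_isWaveMap hψ
  have heq := eqOn_quadrantExtension ψ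
  have hsu : ∀ {u u' v : ℝ}, 0 ≤ u → u ≤ u' → 0 ≤ v →
      ‖ψ (u', v) - ψ (u, v)‖ ≤ arcLength φp u' - arcLength φp u := by
    intro u u' v hu huu' hv
    have h1 := hΨ.sub_u u u' v huu'
    rwa [← h.ac_p.arcLength_sub, ← heq (mk_mem_quadrant (hu.trans huu') hv),
      ← heq (mk_mem_quadrant hu hv)] at h1
  have hsv : ∀ {u v v' : ℝ}, 0 ≤ u → 0 ≤ v → v ≤ v' →
      ‖ψ (u, v') - ψ (u, v)‖ ≤ arcLength φm v' - arcLength φm v := by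
    intro u v v' hu hv hvv'
    have h1 := hΨ.sub_v u v v' hvv'
    rwa [← h.ac_m.arcLength_sub, ← heq (mk_mem_quadrant hu (hv.trans hvv')),
      ← heq (mk_mem_quadrant hu hv)] at h1
  rw [Metric.tendsto_atTop]
  intro ε hε
  obtain ⟨ω, hω0, hω, hωε⟩ := exists_pos_le_half (stabilityConst_pos φp φm K) (half_pos hε)
  obtain ⟨N₀, hN₀⟩ := eventually_atTop.mp (h.eventually_isFineGrid K hω0)
  refine ⟨N₀, fun N hN => ?_⟩
  have hfine := hN₀ N hN
  have hg : ∀ i : ℕ, (0 : ℝ) ≤ (i : ℝ) / 2 ^ N := fun i => by positivity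
  have hgs : ∀ i : ℕ, (i : ℝ) / 2 ^ N ≤ ((i + 1 : ℕ) : ℝ) / 2 ^ N := fun i =>
    monotone_div_two_pow N (Nat.le_succ i)
  set X : ℕ → ℕ → Amb d := fun i j => ψ ((i : ℝ) / 2 ^ N, (j : ℝ) / 2 ^ N) with hX
  have h1 := h.norm_sub_scheme_le (X := X) hω0.le hω hfine
    (fun i j => hsu (hg i) (hgs i) (hg j)) (fun i j => hsv (hg i) (hg j) (hgs j))
    (fun i j _ _ => by
      refine (h.waveMap_rectangle hψ (hg i) (hgs i) (hg j) (hgs j)).trans ?_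
      have h3 := sub_nonneg.mpr (h.ac_p.monotone_arcLength (hgs i))
      have h4 := sub_nonneg.mpr (h.ac_m.monotone_arcLength (hgs j))
      simp only [gridLength]
      gcongr
      norm_num)
    (fun i => by
      have h3 := (hψ ((i : ℝ) / 2 ^ N + 1) 1 (by positivity) one_pos).integral_eq _
        ⟨hg i, by linarith⟩ 0 ⟨le_rfl, zero_le_one⟩
      simpa [hX, h.corner] using h3)
    (fun j => by
      have h3 := (hψ 1 ((j : ℝ) / 2 ^ N + 1) one_pos (by positivity)).integral_eq 0
        ⟨le_rfl, zero_le_one⟩ _ ⟨hg j, by linarith⟩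
      simpa [hX] using h3)
    (floor_lt_mul_two_pow (N := N) hu huK).le (floor_lt_mul_two_pow (N := N) hv hvK).le
  have h2 := hsu (hg ⌊2 ^ N * u⌋₊) (floor_div_le hu) hv
  have h3 := hsv (hg ⌊2 ^ N * u⌋₊) (hg ⌊2 ^ N * v⌋₊) (floor_div_le hv)
  have h4 := gridLength_floor_sub_le h.ac_p hfine.1 hu huK le_rfl
  have h5 := gridLength_floor_sub_le h.ac_m hfine.2 hv hvK le_rfl
  simp only [gridLength] at h4 h5
  rw [dist_eq_norm, norm_sub_rev]
  -- From `(u, v)` to its grid corner, one variable at a time at cost `ω` each, then from the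
  -- sampled wave map to the scheme by stability.
  have e : ψ (u, v) - schemeFloor φp φm N (u, v) =
      (ψ (u, v) - ψ ((⌊2 ^ N * u⌋₊ : ℝ) / 2 ^ N, v)) +
      (ψ ((⌊2 ^ N * u⌋₊ : ℝ) / 2 ^ N, v) - X ⌊2 ^ N * u⌋₊ ⌊2 ^ N * v⌋₊) +
      (X ⌊2 ^ N * u⌋₊ ⌊2 ^ N * v⌋₊ - scheme φp φm N ⌊2 ^ N * u⌋₊ ⌊2 ^ N * v⌋₊) := by
    simp only [schemeFloor]
    abel
  rw [e]
  refine norm_add₃_le.trans_lt ((add_le_add (add_le_add h2 h3) h1).trans_lt ?_)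
  rw [stabilityConst] at hωε
  linarith

theorem tendstoLocallyUniformlyOn (h : IsSphereData φp φm) :
    TendstoLocallyUniformlyOn (fun N : ℕ => schemeSolution N φp φm) (schemeLimit φp φm)
      atTop quadrant := by
  rw [Metric.tendstoLocallyUniformlyOn_iff]
  rintro ε hε ⟨u, v⟩ ⟨-, -⟩
  obtain ⟨K, hK⟩ := exists_nat_gt (max u v)
  refine ⟨quadrant ∩ Iio (K : ℝ) ×ˢ Iio (K : ℝ), inter_mem self_mem_nhdsWithin
    (mem_nhdsWithin_of_mem_nhds (prod_mem_nhds (Iio_mem_nhds ((le_max_left _ _).trans_lt hK))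
      (Iio_mem_nhds ((le_max_right _ _).trans_lt hK)))), ?_⟩
  -- Interpolation costs `2 (ε / 4)`, and the uniform Cauchy bound, with `k → ∞`, another `ε / 4`;
  -- the sum stays below `ε`.
  obtain ⟨N₀, hN₀⟩ := h.exists_forall_norm_schemeFloor_sub_le K (ε := ε / 4) (by positivity)
  filter_upwards [h.eventually_isFineGrid K (ω := ε / 4) (by positivity), eventually_ge_atTop N₀]
    with N hfine hN
  rintro ⟨u, v⟩ ⟨⟨hu, hv⟩, huK, hvK⟩
  have h1 := h.norm_schemeSolution_sub_le hfine hu hv huK hvK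
  have h2 : ‖schemeLimit φp φm (u, v) - schemeFloor φp φm N (u, v)‖ ≤ ε / 4 := by
    have ht := (tendsto_add_atTop_iff_nat N).mpr (h.tendsto_schemeFloor hu hv)
    refine le_of_tendsto (ht.sub_const _).norm (Eventually.of_forall fun k => ?_)
    rw [add_comm k]
    exact hN₀ N hN k u v hu hv huK hvK
  rw [dist_eq_norm, ← sub_sub_sub_cancel_right _ _ (schemeFloor φp φm N (u, v))]
  refine (norm_sub_le _ _).trans_lt ?_
  linarith

end IsSphereData

end

/-- For locally absolutely continuous sphere-valued data, the wave map exists, is unique, and is the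
locally uniform limit on `[0, ∞)²` of the solutions of the discrete scheme. -/
theorem theorem3 (d : ℕ) (φp φm : ℝ → Amb d)
    (hp : ∀ u : ℝ, 0 ≤ u → φp u ∈ unitSphere d)
    (hm : ∀ v : ℝ, 0 ≤ v → φm v ∈ unitSphere d)
    (hp_ac : LocallyAbsCont φp) (hm_ac : LocallyAbsCont φm)
    (h0 : φp 0 = φm 0) :
    ∃ φ : ℝ × ℝ → Amb d,
      IsWaveMap φp φm φ ∧
      (∀ ψ : ℝ × ℝ → Amb d, IsWaveMap φp φm ψ → Set.EqOn ψ φ quadrant) ∧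
      TendstoLocallyUniformlyOn (fun N : ℕ => schemeSolution N φp φm) φ
        Filter.atTop quadrant := by
  have h : IsSphereData φp φm := ⟨hp, hm, hp_ac, hm_ac, h0⟩
  have heq := eqOn_quadrantExtension (schemeLimit φp φm)
  refine ⟨quadrantExtension (schemeLimit φp φm), h.isWaveMap_limit, fun ψ hψ => ?_,
    h.tendstoLocallyUniformlyOn.congr_right heq⟩
  rintro ⟨u, v⟩ ⟨hu, hv⟩
  rw [← heq ⟨hu, hv⟩]
  exact tendsto_nhds_unique (h.tendsto_schemeFloor_of_isWaveMap hψ hu hv)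
    (h.tendsto_schemeFloor hu hv)
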